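/- Let $0<d<\pi/2$ and let $\mathscr{D}_d=\{\zeta\in\mathbb{C}:|\operatorname{Im}\zeta|<d\}$. Let $\psi(\zeta)=\log(1+\mathrm{e}^{\pi\sinh\zeta})$, where the logarithm is the branch that is analytic on the strip $|\operatorname{Im}\zeta|<\pi/2$ and real on the real line. Let $f$ be analytic in $\psi(\mathscr{D}_d)$, and assume that there are constants $K>0$, $\beta>0$ and $0<\alpha\le 1$ with $$|f(z)|\le K\left|\left(\frac{z}{1+z}\right)^{\alpha-1}\mathrm{e}^{-\beta z}\right|\qquad\text{for all } z\in\psi(\mathscr{D}_d)$$ (for $z=-1$ the power is read as $0$ if $\alpha<1$ and as $1$ if $\alpha=1$). Put $\mu=\min\{\alpha,\beta\}$ and $\nu=\max\{\alpha,\beta\}$. For $\gamma>0$ let $$x_\gamma=\begin{cases}\operatorname{arcsinh}\left(\dfrac{\sqrt{1+\sqrt{1-(2\pi\gamma)^2}}}{2\pi\gamma}\right)&\text{if }0<\gamma<1/(2\pi),\\[2ex]\operatorname{arcsinh}(1)&\text{if }\gamma\ge 1/(2\pi).\end{cases}$$ Then $f$ is integrable on $(0,\infty)$. Moreover, let $n$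 be a natural number, let $h=\log(4dn/\mu)/n$, and let $$\begin{cases}M=n,\quad N=n-\lfloor\log(\beta/\alpha)/h\rfloor&\text{if }\mu=\alpha,\\ N=n,\quad M=n-\lfloor\log(\alpha/\beta)/h\rfloor&\text{if }\mu=\beta.\end{cases}$$ If $n$ is sufficiently large, in the sense that $n\ge \nu\mathrm{e}/(4d)$, $Mh\ge x_\alpha$ and $Nh\ge x_\beta$, then $$\left|\int_0^\infty f(t)\,\mathrm{d}t-h\sum_{k=-M}^{N}f(\psi(kh))\,\psi'(kh)\right|\le C_{3\ddagger}\,\mathrm{e}^{-2\pi dn/\log(4dn/\mu)},$$ where $C_{3\ddagger}$ is the constant, independent of $n$, $$C_{3\ddagger}=\frac{2K}{\mu}\left\{\frac{2\,(\tilde c_d)^{1-\alpha}}{(1-\mathrm{e}^{-\pi\mu\mathrm{e}/2})\{\cos(\frac{\pi}{2}\sin d)\}^{\alpha+\beta}\cos d}+\mathrm{e}^{\pi(1-\alpha+6\nu)/12}\right\},$$ $$\tilde c_d=\frac{1+\log(1+c_d)}{\log(1+c_d)}\,c_d,\qquad c_d=1+\frac{1}{\cos(\frac{\pi}{2}\sin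 d)}.$$ This rate is better than the rates $\mathrm{e}^{-2\pi dn/\log(8dn/\mu)}$ and $\mathrm{e}^{-2\pi dn/\log(2\pi dn/\mu)}$ of the earlier DE transformations for this case: for the same $d$ and $\mu$, as $n\to\infty$, $$\mathrm{e}^{-2\pi dn/\log(4dn/\mu)}=o\!\left(\mathrm{e}^{-2\pi dn/\log(cdn/\mu)}\right)\qquad\text{for } c=8\text{ and } c=2\pi.$$ -/

import Mathlib

open Asymptotics

noncomputable section

namespace SincDE

/-- The strip `𝒟_d = {ζ : |Im ζ| < d}`. -/
def strip (d : ℝ) : Set ℂ := {ζ | |ζ.im| < d}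

/-- The analytic branch of `log (1 + exp w)` on the plane cut along `{i t : |t| ≥ π}` that is real
for real `w`. For `Re w ≤ 0` it is the principal logarithm of `1 + exp w`; for `Re w > 0` it is
`w` plus the principal logarithm of `1 + exp (-w)`. (The principal logarithm of `1 + exp w` itself
jumps when `1 + exp w` crosses the negative real axis.) -/
def logOneAddExp (w : ℂ) : ℂ :=
  if w.re ≤ 0 then Complex.log (1 + Complex.exp w)
  else w + Complex.log (1 + Complex.exp (-w))

/-- The transformation `ψ(ζ) = log (1 + exp (π sinh ζ))`: on the strip `|Im ζ| < π / 2` it is the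
analytic branch that is real on the real line, see `exp_psi`, `psi_ofReal`,
`differentiableOn_psi`. -/
def psi (ζ : ℂ) : ℂ := logOneAddExp (Real.pi * Complex.sinh ζ)

/-- `E₃(z; α, β) = (z / (1 + z)) ^ (α - 1) * exp (-β z)`. Only its modulus is used, and the modulus
of a real power does not depend on the branch. At `z = -1` (where `z / (1 + z)` is `0` in Lean) the
value of the first factor is `0` for `α < 1` and `1` for `α = 1`, in agreement with
`((1 + z) / z) ^ (1 - α)`. -/
def E3 (α β : ℝ) (z : ℂ) : ℂ :=
  (z / (1 + z)) ^ ((α - 1 : ℝ) : ℂ) * Complex.exp (-(β : ℂ) * z)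

/-- The threshold `x_γ`, for `γ > 0`. -/
def xThreshold (γ : ℝ) : ℝ :=
  if γ < 1 / (2 * Real.pi) then
    Real.arsinh (Real.sqrt (1 + Real.sqrt (1 - (2 * Real.pi * γ) ^ 2)) / (2 * Real.pi * γ))
  else Real.arsinh 1

/-- The mesh size `h = log (4 d n / μ) / n`. -/
def mesh (d μ : ℝ) (n : ℕ) : ℝ := Real.log (4 * d * n / μ) / n

/-- The lower truncation number `M`: `n` if `min α β = α`, and `n - ⌊log (α / β) / h⌋` otherwise. -/
def lowerNum (α β h : ℝ) (n : ℕ) : ℤ :=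
  if min α β = α then n else n - ⌊Real.log (α / β) / h⌋

/-- The upper truncation number `N`: `n` if `min α β = β`, and `n - ⌊log (β / α) / h⌋` otherwise. -/
def upperNum (α β h : ℝ) (n : ℕ) : ℤ :=
  if min α β = β then n else n - ⌊Real.log (β / α) / h⌋

/-- `c_d = 1 + 1 / cos ((π / 2) sin d)`. -/
def cConst (d : ℝ) : ℝ := 1 + 1 / Real.cos (Real.pi / 2 * Real.sin d)

/-- `c̃_d = (1 + log (1 + c_d)) / log (1 + c_d) * c_d`. -/
def cTilde (d : ℝ) : ℝ :=
  (1 + Real.log (1 + cConst d)) / Real.log (1 + cConst d) * cConst d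

/-- The explicit constant of the error bound. -/
def errorConst (K α β d : ℝ) : ℝ :=
  2 * K / min α β *
    (2 * cTilde d ^ (1 - α) /
        ((1 - Real.exp (-(Real.pi * min α β * Real.exp 1 / 2))) *
          Real.cos (Real.pi / 2 * Real.sin d) ^ (α + β) * Real.cos d) +
      Real.exp (Real.pi * (1 - α + 6 * max α β) / 12))

/-! The following facts show that `psi` is the branch it is said to be. -/

theorem one_add_exp_mem_slitPlane_of_re_neg {w : ℂ} (hw : w.re < 0) :
    1 + Complex.exp w ∈ Complex.slitPlane := by
  left
  have h1 : |(Complex.exp w).re| ≤ ‖Complex.exp w‖ := Complex.abs_re_le_norm _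
  rw [Complex.norm_exp] at h1
  have h2 : Real.exp w.re < 1 := by simpa using hw
  have h3 := neg_abs_le (Complex.exp w).re
  simp only [Complex.add_re, Complex.one_re]
  linarith

theorem one_add_exp_mem_slitPlane_of_im {w : ℂ} (hw : |w.im| < Real.pi) :
    1 + Complex.exp w ∈ Complex.slitPlane := by
  by_cases h : w.im = 0
  · left
    simp only [Complex.add_re, Complex.one_re, Complex.exp_re, h, Real.cos_zero, mul_one]
    positivity
  · right
    simp only [Complex.add_im, Complex.one_im, Complex.exp_im, zero_add]
    refine mul_ne_zero (Real.exp_pos _).ne' ?_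
    intro h0
    obtain ⟨h1, h2⟩ := abs_lt.1 hw
    exact h ((Real.sin_eq_zero_iff_of_lt_of_lt h1 h2).1 h0)

theorem logOneAddExp_aux {w : ℂ} (hre : 0 < w.re) (him : |w.im| < Real.pi) :
    w + Complex.log (1 + Complex.exp (-w)) = Complex.log (1 + Complex.exp w) := by
  have hs1 : 1 + Complex.exp (-w) ∈ Complex.slitPlane :=
    one_add_exp_mem_slitPlane_of_re_neg (by simpa using hre)
  have hs2 := one_add_exp_mem_slitPlane_of_im him
  have hexp : Complex.exp (w + Complex.log (1 + Complex.exp (-w))) =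
      Complex.exp (Complex.log (1 + Complex.exp w)) := by
    rw [Complex.exp_add, Complex.exp_log (Complex.slitPlane_ne_zero hs1),
      Complex.exp_log (Complex.slitPlane_ne_zero hs2), mul_add, ← Complex.exp_add]
    simp [add_comm]
  obtain ⟨k, hk⟩ := Complex.exp_eq_exp_iff_exists_int.1 hexp
  have him' := congrArg Complex.im hk
  have hrepos : 0 < (1 + Complex.exp (-w)).re := by
    have h1 : |(Complex.exp (-w)).re| ≤ ‖Complex.exp (-w)‖ := Complex.abs_re_le_norm _
    rw [Complex.norm_exp] at h1
    have h2 : Real.exp (-w).re < 1 := by simpa using hre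
    have h3 := neg_abs_le (Complex.exp (-w)).re
    simp only [Complex.add_re, Complex.one_re]
    linarith
  have harg := abs_lt.1 (Complex.abs_arg_lt_pi_div_two_iff.2 (Or.inl hrepos))
  have hB1 := Complex.neg_pi_lt_arg (1 + Complex.exp w)
  have hB2 := Complex.arg_le_pi (1 + Complex.exp w)
  have e : (k * (2 * (Real.pi : ℂ) * Complex.I)).im = k * (2 * Real.pi) := by
    simp
  rw [Complex.add_im, Complex.add_im, e, Complex.log_im, Complex.log_im] at him'
  obtain ⟨l1, l2⟩ := abs_lt.1 him
  have hpi := Real.pi_pos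
  have himA : (1 + Complex.exp (-w)).im = -(Real.exp (-w.re) * Real.sin w.im) := by
    simp [Complex.exp_im]
  have himB : (1 + Complex.exp w).im = Real.exp w.re * Real.sin w.im := by
    simp [Complex.exp_im]
  have hk0 : k = 0 := by
    have key : |(k : ℝ) * (2 * Real.pi)| < 2 * Real.pi := by
      rcases le_total 0 w.im with h0 | h0
      · have hsin : 0 ≤ Real.sin w.im := Real.sin_nonneg_of_nonneg_of_le_pi h0 l2.le
        have hb : 0 ≤ Complex.arg (1 + Complex.exp w) := by
          rw [Complex.arg_nonneg_iff, himB]; positivity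
        have ha : Complex.arg (1 + Complex.exp (-w)) ≤ Real.pi / 2 := harg.2.le
        rw [abs_lt]
        constructor <;> linarith [harg.1]
      · have hsin : Real.sin w.im ≤ 0 := Real.sin_nonpos_of_nonpos_of_neg_pi_le h0 l1.le
        have hb : Complex.arg (1 + Complex.exp w) ≤ 0 := by
          rcases h0.lt_or_eq with h0' | h0'
          · have : Real.sin w.im < 0 := Real.sin_neg_of_neg_of_neg_pi_lt h0' l1
            refine (Complex.arg_neg_iff.2 ?_).le
            rw [himB]
            exact mul_neg_of_pos_of_neg (Real.exp_pos _) this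
          · refine le_of_eq (Complex.arg_eq_zero_iff.2 ⟨?_, ?_⟩)
            · simp only [Complex.add_re, Complex.one_re, Complex.exp_re, h0', Real.cos_zero]
              positivity
            · rw [himB, h0']; simp
        rw [abs_lt]
        constructor <;> linarith [harg.2, harg.1]
    rw [abs_mul, abs_of_pos (by positivity : (0 : ℝ) < 2 * Real.pi)] at key
    have h1 : |(k : ℝ)| < 1 := by
      by_contra hcon
      push Not at hcon
      nlinarith
    have h2 : |k| < 1 := by exact_mod_cast h1
    exact Int.abs_lt_one_iff.1 h2
  rw [hk, hk0]
  simp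

theorem pi_mul_sinh_re_im (ζ : ℂ) :
    ((Real.pi : ℂ) * Complex.sinh ζ).re = Real.pi * (Real.sinh ζ.re * Real.cos ζ.im) ∧
    ((Real.pi : ℂ) * Complex.sinh ζ).im = Real.pi * (Real.cosh ζ.re * Real.sin ζ.im) := by
  have h : Complex.sinh ζ = ((Real.sinh ζ.re * Real.cos ζ.im : ℝ) : ℂ) +
      ((Real.cosh ζ.re * Real.sin ζ.im : ℝ) : ℂ) * Complex.I := by
    conv_lhs => rw [← Complex.re_add_im ζ]
    rw [Complex.sinh_add, Complex.cosh_mul_I, Complex.sinh_mul_I]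
    push_cast
    ring
  rw [h]
  constructor
  · rw [Complex.re_ofReal_mul, Complex.add_re, Complex.ofReal_re, Complex.re_ofReal_mul]
    simp
  · rw [Complex.im_ofReal_mul, Complex.add_im, Complex.ofReal_im, Complex.im_ofReal_mul]
    simp

theorem pi_mul_sinh_cut {ζ : ℂ} (hζ : ζ ∈ strip (Real.pi / 2)) :
    ((Real.pi : ℂ) * Complex.sinh ζ).re ≠ 0 ∨
      |((Real.pi : ℂ) * Complex.sinh ζ).im| < Real.pi := by
  obtain ⟨h1, h2⟩ := abs_lt.1 (show |ζ.im| < Real.pi / 2 from hζ)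
  have hcos : 0 < Real.cos ζ.im := Real.cos_pos_of_mem_Ioo ⟨h1, h2⟩
  rw [(pi_mul_sinh_re_im ζ).1, (pi_mul_sinh_re_im ζ).2]
  by_cases h : ζ.re = 0
  · right
    rw [h, Real.cosh_zero, one_mul, abs_mul, abs_of_pos Real.pi_pos]
    have : |Real.sin ζ.im| < 1 := by
      rw [← sq_lt_one_iff_abs_lt_one]
      nlinarith [Real.sin_sq_add_cos_sq ζ.im]
    nlinarith [Real.pi_pos]
  · left
    exact mul_ne_zero Real.pi_pos.ne' (mul_ne_zero (by simpa [Real.sinh_eq_zero] using h) hcos.ne')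

theorem one_add_exp_ne_zero {w : ℂ} (hw : w.re ≠ 0 ∨ |w.im| < Real.pi) :
    1 + Complex.exp w ≠ 0 := by
  rcases hw with h | h
  · intro h0
    have h1 : Complex.exp w = -1 := by linear_combination h0
    have h2 : Real.exp w.re = 1 := by rw [← Complex.norm_exp, h1]; simp
    exact h (by simpa using h2)
  · exact Complex.slitPlane_ne_zero (one_add_exp_mem_slitPlane_of_im h)

/-- `psi` is a logarithm of `1 + exp (π sinh ζ)` on the strip `|Im ζ| < π / 2`. -/
theorem exp_psi {ζ : ℂ} (hζ : ζ ∈ strip (Real.pi / 2)) :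
    Complex.exp (psi ζ) = 1 + Complex.exp (Real.pi * Complex.sinh ζ) := by
  have hne := one_add_exp_ne_zero (pi_mul_sinh_cut hζ)
  unfold psi logOneAddExp
  split_ifs with h
  · exact Complex.exp_log hne
  · rw [Complex.exp_add, Complex.exp_log, mul_add, ← Complex.exp_add]
    · simp [add_comm]
    · refine one_add_exp_ne_zero (Or.inl ?_)
      simpa using (not_le.1 h).ne'

/-- On the real line `psi` is the real function `log (1 + exp (π sinh t))`. -/
theorem psi_ofReal (t : ℝ) :
    psi t = ((Real.log (1 + Real.exp (Real.pi * Real.sinh t)) : ℝ) : ℂ) := by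
  have h0 : (Real.pi : ℂ) * Complex.sinh (t : ℂ) = ((Real.pi * Real.sinh t : ℝ) : ℂ) := by
    push_cast
    rfl
  have h1 : psi t = Complex.log (1 + Complex.exp (Real.pi * Complex.sinh t)) := by
    unfold psi logOneAddExp
    split_ifs with h
    · rfl
    · refine logOneAddExp_aux (not_le.1 h) ?_
      rw [h0, Complex.ofReal_im]
      simpa using Real.pi_pos
  rw [h1, h0, Complex.ofReal_log (by positivity)]
  push_cast
  rfl

/-- `psi` is holomorphic on the strip `|Im ζ| < π / 2`. -/
theorem differentiableOn_psi : DifferentiableOn ℂ psi (strip (Real.pi / 2)) := by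
  intro ζ hζ
  refine DifferentiableAt.differentiableWithinAt ?_
  have hin : DifferentiableAt ℂ (fun ζ : ℂ => (Real.pi : ℂ) * Complex.sinh ζ) ζ := by fun_prop
  refine DifferentiableAt.comp (g := logOneAddExp) ζ ?_ hin
  have hcut := pi_mul_sinh_cut hζ
  generalize (Real.pi : ℂ) * Complex.sinh ζ = w at hcut
  have A : 1 + Complex.exp w ∈ Complex.slitPlane →
      DifferentiableAt ℂ (fun w => Complex.log (1 + Complex.exp w)) w := fun h =>
    DifferentiableAt.clog (by fun_prop) h
  by_cases him : |w.im| < Real.pi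
  · refine (A (one_add_exp_mem_slitPlane_of_im him)).congr_of_eventuallyEq ?_
    have : ∀ᶠ v : ℂ in nhds w, |v.im| < Real.pi :=
      (Complex.continuous_im.abs).continuousAt.eventually_lt continuousAt_const him
    filter_upwards [this] with v hv
    unfold logOneAddExp
    split_ifs with h
    · rfl
    · exact logOneAddExp_aux (not_le.1 h) hv
  · have hre : w.re ≠ 0 := hcut.resolve_right him
    rcases lt_or_gt_of_ne hre with h | h
    · refine (A (one_add_exp_mem_slitPlane_of_re_neg h)).congr_of_eventuallyEq ?_
      have : ∀ᶠ v : ℂ in nhds w, v.re < 0 :=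
        Complex.continuous_re.continuousAt.eventually_lt continuousAt_const h
      filter_upwards [this] with v hv
      simp [logOneAddExp, hv.le]
    · have hs : 1 + Complex.exp (-w) ∈ Complex.slitPlane :=
        one_add_exp_mem_slitPlane_of_re_neg (by simpa using h)
      have B : DifferentiableAt ℂ (fun w => w + Complex.log (1 + Complex.exp (-w))) w :=
        differentiableAt_id.add (DifferentiableAt.clog (by fun_prop) hs)
      refine B.congr_of_eventuallyEq ?_
      have : ∀ᶠ v : ℂ in nhds w, 0 < v.re :=
        continuousAt_const.eventually_lt Complex.continuous_re.continuousAt h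
      filter_upwards [this] with v hv
      simp [logOneAddExp, not_le.2 hv]

end SincDE

end

/-! The substitution `t = ψ(x)` turns the integral over `(0, ∞)` into the integral over the line of
`g = (f ∘ ψ) ψ'`. With `w = π sinh ζ` one has `exp (-ψ) = 1 / (1 + exp w)`, `1 - exp (-ψ) = 1 / (1 +
exp (-w))` and `ψ' = π cosh ζ (1 - exp (-ψ))`. The singular factor `|(1 + ψ) / ψ| ^ (1 - α)` is
absorbed by part of the factor `1 - exp (-ψ)` of `ψ'`; what remains is `|1 - exp (-ψ)| ^ α |exp
(-ψ)| ^ β`, which decays like `exp (-μ |Re w|)`. Everything rests on a lower bound for `|1 + exp w|`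
that loses only the factor `cos ((π / 2) sin d)` (`one_add_exp_mul_cos_le_norm`). The result is a
double exponential majorant of `g` depending on `Re ζ` alone (`norm_integrand_le`).

Discretization: by Poisson summation the error of the infinite trapezoidal sum consists of the
Fourier coefficients of `g` at the nonzero multiples of `1 / h`. Shifting the line of integration
across the strip bounds them by a geometric series of ratio `exp (-2πd / h)`, and this ratio is the
claimed rate.

Truncation: on the real line the constant improves to `exp (π / 12) ^ (1 - α)`, and the tails are
sums of `cosh x exp (-πγ sinh x)` with `γ = α, β`, which are compared with integrals. The truncation
numbers give `γ exp X ≥ 4dn` at the cut-off `X`, so a summand decreasing beyond `X` leaves a tail of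
order `exp (-2πdn)`, better than required by the factor `log (4dn / μ)` in the exponent. This slack
pays for the case where `X` precedes the maximum of the summand; the threshold `x_γ` limits how far
it may precede it (`exp_neg_mul_one_add_le`, `tail_sum_le`). -/

namespace SincDE

/-! ### Lower bound for `1 + exp (π sinh ζ)` on the strip -/

open Real in
-- Factor the right side as `(π/2 - A) (π/2 + A) sin A`: the first factor dominates `cos A`, and the
-- rest dominates `A` by Jordan's inequality.
theorem mul_cos_le_mul_sin {A : ℝ} (h0 : 0 ≤ A) (h1 : A ≤ π / 2) :
    A * cos A ≤ ((π / 2) ^ 2 - A ^ 2) * sin A := by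
  have hpi := pi_pos
  have hcos : cos A ≤ π / 2 - A := by
    rw [← sin_pi_div_two_sub]
    exact sin_le (by linarith)
  have hsin : 2 / π * A ≤ sin A := mul_le_sin h0 h1
  have h2 : A ≤ (π / 2 + A) * sin A := by
    have h3 : (π / 2 + A) * (2 / π * A) = A + 2 / π * A ^ 2 := by field_simp
    have h4 : 0 ≤ 2 / π * A ^ 2 := by positivity
    nlinarith [mul_le_mul_of_nonneg_left hsin (by linarith : 0 ≤ π / 2 + A)]
  calc A * cos A ≤ A * (π / 2 - A) := mul_le_mul_of_nonneg_left hcos h0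
    _ ≤ ((π / 2 + A) * sin A) * (π / 2 - A) := mul_le_mul_of_nonneg_right h2 (by linarith)
    _ = _ := by ring

open Real in
theorem one_add_sq_div_two_le_cosh (t : ℝ) : 1 + t ^ 2 / 2 ≤ cosh t := by
  have h1 : cosh t = 1 + 2 * sinh (t / 2) ^ 2 := by
    have := cosh_two_mul (t / 2)
    rw [mul_div_cancel₀ t two_ne_zero, cosh_sq] at this
    linarith
  have h2 : (t / 2) ^ 2 ≤ sinh (t / 2) ^ 2 := by
    rw [sq_le_sq]
    rcases le_total 0 (t / 2) with h | h
    · rw [abs_of_nonneg h, abs_of_nonneg (sinh_nonneg_iff.2 h)]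
      exact self_le_sinh_iff.2 h
    · rw [abs_of_nonpos h, abs_of_nonpos (sinh_nonpos_iff.2 h)]
      linarith [sinh_le_self_iff.2 h]
  rw [h1]
  linarith

open Real in
theorem abs_sin_add_le {A t : ℝ} (hs : 0 ≤ sin A) (hc : 0 ≤ cos A) (ht : 0 ≤ t) :
    |sin (A + t)| ≤ sin A + cos A * t := by
  rw [sin_add]
  have h1 := abs_cos_le_one t
  have h2 : |sin t| ≤ t := abs_sin_le_abs.trans_eq (abs_of_nonneg ht)
  calc _ ≤ |sin A * cos t| + |cos A * sin t| := abs_add_le _ _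
    _ = sin A * |cos t| + cos A * |sin t| := by
        rw [abs_mul, abs_mul, abs_of_nonneg hs, abs_of_nonneg hc]
    _ ≤ sin A * 1 + cos A * t := by gcongr
    _ = _ := by ring

open Real in
-- With `A = (π/2) |sin y|` and `B = (π/2) cos y`, so that `(π/2)² - A² = B²`, expand the sine about
-- `A`: the left side is at most `sin A + A cos A (cosh x - 1) ≤ sin A (1 + B² (cosh x - 1))`. Since
-- `sinh² x ≥ 2 (cosh x - 1)`, the bracket is at most `1 + (B sinh x)² / 2 ≤ cosh (B sinh x)`.
theorem abs_sin_mul_cosh_le (x y : ℝ) :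
    |sin (π / 2 * (cosh x * sin y))| ≤
      sin (π / 2 * |sin y|) * cosh (π / 2 * (sinh x * cos y)) := by
  have hpi := pi_pos
  set A := π / 2 * |sin y| with hA
  have hA0 : 0 ≤ A := by positivity
  have hA1 : A ≤ π / 2 := by
    have := abs_sin_le_one y
    rw [hA]; nlinarith
  have e : |sin (π / 2 * (cosh x * sin y))| = |sin (A + A * (cosh x - 1))| := by
    rcases le_total 0 (sin y) with h | h
    · rw [hA, abs_of_nonneg h]; ring_nf
    · rw [hA, abs_of_nonpos h, ← abs_neg, ← sin_neg]; ring_nf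
  have hs : 0 ≤ sin A := sin_nonneg_of_nonneg_of_le_pi hA0 (by linarith)
  have hc : 0 ≤ cos A := cos_nonneg_of_mem_Icc ⟨by linarith, hA1⟩
  have hx : 1 ≤ cosh x := one_le_cosh x
  rw [e]
  refine (abs_sin_add_le hs hc (mul_nonneg hA0 (by linarith))).trans ?_
  have h1 := mul_cos_le_mul_sin hA0 hA1
  have hB : (π / 2) ^ 2 - A ^ 2 = (π / 2 * cos y) ^ 2 := by
    rw [hA, mul_pow, sq_abs, mul_pow, cos_sq']
    ring
  rw [hB] at h1
  have h2 : 1 + (π / 2 * cos y) ^ 2 * (cosh x - 1) ≤ cosh (π / 2 * (sinh x * cos y)) := by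
    refine le_trans ?_ (one_add_sq_div_two_le_cosh _)
    have : (π / 2 * (sinh x * cos y)) ^ 2 = (π / 2 * cos y) ^ 2 * (cosh x ^ 2 - 1) := by
      rw [cosh_sq]; ring
    rw [this]
    nlinarith [mul_nonneg (sq_nonneg (π / 2 * cos y)) (mul_self_nonneg (cosh x - 1))]
  calc sin A + cos A * (A * (cosh x - 1)) = sin A + (A * cos A) * (cosh x - 1) := by ring
    _ ≤ sin A + ((π / 2 * cos y) ^ 2 * sin A) * (cosh x - 1) := by
        gcongr
    _ = sin A * (1 + (π / 2 * cos y) ^ 2 * (cosh x - 1)) := by ring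
    _ ≤ _ := mul_le_mul_of_nonneg_left h2 hs

theorem norm_one_add_exp_sq (w : ℂ) :
    ‖1 + Complex.exp w‖ ^ 2 =
      (1 + Real.exp w.re) ^ 2 - 4 * Real.exp w.re * Real.sin (w.im / 2) ^ 2 := by
  rw [← Complex.normSq_eq_norm_sq, Complex.normSq_apply]
  simp only [Complex.add_re, Complex.one_re, Complex.add_im, Complex.one_im, Complex.exp_re,
    Complex.exp_im, zero_add]
  have h1 : Real.cos w.im = 1 - 2 * Real.sin (w.im / 2) ^ 2 := by
    have := Real.cos_two_mul (w.im / 2)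
    rw [mul_div_cancel₀ _ two_ne_zero, Real.cos_sq'] at this
    linarith
  have h2 := Real.sin_sq_add_cos_sq w.im
  linear_combination (Real.exp w.re) ^ 2 * h2 + 2 * Real.exp w.re * h1

theorem one_add_exp_sq (s : ℝ) :
    (1 + Real.exp s) ^ 2 = 4 * Real.exp s * Real.cosh (s / 2) ^ 2 := by
  rw [Real.cosh_eq]
  have h1 : Real.exp s = Real.exp (s / 2) * Real.exp (s / 2) := by rw [← Real.exp_add]; ring_nf
  have h2 : Real.exp (s / 2) * Real.exp (-(s / 2)) = 1 := by rw [← Real.exp_add]; simp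
  set p := Real.exp (s / 2)
  set r := Real.exp (-(s / 2))
  rw [h1]
  linear_combination -(2 * p ^ 2 + p * r + 1) * h2

/-- The constant `cos ((π / 2) sin d)` is positive for `0 < d < π / 2`. -/
theorem cos_pi_div_two_mul_sin_pos {d : ℝ} (hd0 : 0 < d) (hd : d < Real.pi / 2) :
    0 < Real.cos (Real.pi / 2 * Real.sin d) := by
  have hpi := Real.pi_pos
  have h1 : Real.sin d < 1 := by
    have := Real.sin_lt_sin_of_lt_of_le_pi_div_two (by linarith) le_rfl hd
    simpa using this
  have h0 : 0 < Real.sin d := Real.sin_pos_of_pos_of_lt_pi hd0 (by linarith)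
  exact Real.cos_pos_of_mem_Ioo ⟨by nlinarith, by nlinarith⟩

/-- For `w = s + iv`, `|1 + exp w|² = 4 exp s (cosh² (s/2) - sin² (v/2))` and `(1 + exp s)² = 4 exp
s cosh² (s/2)`. The claim is thus `sin² (v/2) ≤ sin² ((π/2) sin d) cosh² (s/2)`, which is
`abs_sin_mul_cosh_le` together with `|sin (Im ζ)| ≤ sin d`. -/
theorem one_add_exp_mul_cos_le_norm {d : ℝ} (hd0 : 0 < d) (hd : d < Real.pi / 2) {ζ : ℂ}
    (hζ : ζ ∈ strip d) :
    (1 + Real.exp (Real.pi * (Real.sinh ζ.re * Real.cos ζ.im))) *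
        Real.cos (Real.pi / 2 * Real.sin d) ≤
      ‖1 + Complex.exp (Real.pi * Complex.sinh ζ)‖ := by
  have hpi := Real.pi_pos
  have hζ' : |ζ.im| < d := hζ
  have hc := cos_pi_div_two_mul_sin_pos hd0 hd
  obtain ⟨hre, him⟩ := pi_mul_sinh_re_im ζ
  rw [← abs_of_pos (mul_pos (by positivity : 0 <
    1 + Real.exp (Real.pi * (Real.sinh ζ.re * Real.cos ζ.im))) hc), ← abs_norm, ← sq_le_sq,
    norm_one_add_exp_sq, hre, him, mul_pow, Real.cos_sq']
  set s := Real.pi * (Real.sinh ζ.re * Real.cos ζ.im) with hs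
  have h1 := abs_sin_mul_cosh_le ζ.re ζ.im
  have hsin : |Real.sin ζ.im| ≤ Real.sin d := by
    have hmono : ∀ y, 0 ≤ y → y ≤ d → Real.sin y ≤ Real.sin d := fun y hy0 hy =>
      Real.sin_le_sin_of_le_of_le_pi_div_two (by linarith) hd.le hy
    have h0 : 0 ≤ Real.sin |ζ.im| :=
      Real.sin_nonneg_of_nonneg_of_le_pi (abs_nonneg _) (by linarith)
    have h2 : |Real.sin ζ.im| = Real.sin |ζ.im| := by
      rcases abs_choice ζ.im with h | h
      · rw [h] at h0 ⊢; exact abs_of_nonneg h0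
      · rw [h, Real.sin_neg] at h0 ⊢; exact abs_of_nonpos (by linarith)
    rw [h2]
    exact hmono _ (abs_nonneg _) hζ'.le
  have hd1 : Real.sin d ≤ 1 := Real.sin_le_one d
  have h2 : Real.sin (Real.pi / 2 * |Real.sin ζ.im|) ≤ Real.sin (Real.pi / 2 * Real.sin d) :=
    Real.sin_le_sin_of_le_of_le_pi_div_two
      (by have : 0 ≤ Real.pi / 2 * |Real.sin ζ.im| := by positivity
          linarith) (by nlinarith) (by gcongr)
  have h3 : |Real.sin (Real.pi / 2 * (Real.cosh ζ.re * Real.sin ζ.im))| ≤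
      |Real.sin (Real.pi / 2 * Real.sin d) * Real.cosh (s / 2)| := by
    refine h1.trans (le_trans ?_ (le_abs_self _))
    have e : Real.pi / 2 * (Real.sinh ζ.re * Real.cos ζ.im) = s / 2 := by rw [hs]; ring
    rw [e]
    exact mul_le_mul_of_nonneg_right h2 (Real.cosh_pos _).le
  have h4 := sq_le_sq.2 h3
  have e2 : Real.pi * (Real.cosh ζ.re * Real.sin ζ.im) / 2 =
      Real.pi / 2 * (Real.cosh ζ.re * Real.sin ζ.im) := by ring
  rw [e2, one_add_exp_sq]
  nlinarith [mul_le_mul_of_nonneg_left h4 (by positivity : 0 ≤ 4 * Real.exp s)]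

theorem neg_mem_strip {d : ℝ} {ζ : ℂ} (hζ : ζ ∈ strip d) : -ζ ∈ strip d := by
  simpa [strip] using hζ

theorem one_add_exp_neg_mul_cos_le_norm {d : ℝ} (hd0 : 0 < d) (hd : d < Real.pi / 2) {ζ : ℂ}
    (hζ : ζ ∈ strip d) :
    (1 + Real.exp (-(Real.pi * (Real.sinh ζ.re * Real.cos ζ.im)))) *
        Real.cos (Real.pi / 2 * Real.sin d) ≤
      ‖1 + Complex.exp (-(Real.pi * Complex.sinh ζ))‖ := by
  simpa using one_add_exp_mul_cos_le_norm hd0 hd (neg_mem_strip hζ)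

/-! ### Identities for `ψ` and bounds for the transformed integrand -/

theorem strip_mono {d e : ℝ} (h : d ≤ e) : strip d ⊆ strip e := fun _ hζ =>
  lt_of_lt_of_le (show |_| < d from hζ) h

theorem isOpen_strip (d : ℝ) : IsOpen (strip d) :=
  isOpen_lt (Complex.continuous_im.abs) continuous_const

theorem one_add_exp_pi_sinh_ne_zero {ζ : ℂ} (hζ : ζ ∈ strip (Real.pi / 2)) :
    1 + Complex.exp (Real.pi * Complex.sinh ζ) ≠ 0 :=
  one_add_exp_ne_zero (pi_mul_sinh_cut hζ)

theorem exp_neg_psi {ζ : ℂ} (hζ : ζ ∈ strip (Real.pi / 2)) :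
    Complex.exp (-psi ζ) = (1 + Complex.exp (Real.pi * Complex.sinh ζ))⁻¹ := by
  rw [Complex.exp_neg, exp_psi hζ]

theorem one_sub_exp_neg_psi {ζ : ℂ} (hζ : ζ ∈ strip (Real.pi / 2)) :
    1 - Complex.exp (-psi ζ) = (1 + Complex.exp (-(Real.pi * Complex.sinh ζ)))⁻¹ := by
  have h1 := one_add_exp_pi_sinh_ne_zero hζ
  have h2 : 1 + Complex.exp (-(Real.pi * Complex.sinh ζ)) ≠ 0 := by
    simpa using one_add_exp_pi_sinh_ne_zero (neg_mem_strip hζ)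
  rw [exp_neg_psi hζ]
  have h3 : Complex.exp (Real.pi * Complex.sinh ζ) *
      Complex.exp (-(Real.pi * Complex.sinh ζ)) = 1 := by
    rw [← Complex.exp_add]; simp
  field_simp
  linear_combination h3

theorem psi_ne_zero {ζ : ℂ} (hζ : ζ ∈ strip (Real.pi / 2)) : psi ζ ≠ 0 := by
  intro h
  have h1 := exp_psi hζ
  rw [h, Complex.exp_zero] at h1
  exact Complex.exp_ne_zero (Real.pi * Complex.sinh ζ) (by linear_combination -h1)

/-- Differentiating `exp ψ = 1 + exp (π sinh ζ)` avoids the two branches in the definition of `psi`.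
-/
theorem deriv_psi {ζ : ℂ} (hζ : ζ ∈ strip (Real.pi / 2)) :
    deriv psi ζ = Real.pi * Complex.cosh ζ * (1 - Complex.exp (-psi ζ)) := by
  have hd : HasDerivAt psi (deriv psi ζ) ζ :=
    ((differentiableOn_psi ζ hζ).differentiableAt ((isOpen_strip _).mem_nhds hζ)).hasDerivAt
  have h1 := hd.cexp
  have h2 : HasDerivAt (fun z : ℂ => 1 + Complex.exp (Real.pi * Complex.sinh z))
      (Complex.exp (Real.pi * Complex.sinh ζ) * (Real.pi * Complex.cosh ζ)) ζ :=
    (((Complex.hasDerivAt_sinh ζ).const_mul _).cexp).const_add 1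
  have h3 : (fun z => Complex.exp (psi z)) =ᶠ[nhds ζ]
      fun z : ℂ => 1 + Complex.exp (Real.pi * Complex.sinh z) := by
    filter_upwards [(isOpen_strip _).mem_nhds hζ] with z hz using exp_psi hz
  have h4 := h1.unique (h2.congr_of_eventuallyEq h3)
  have h5 : Complex.exp (Real.pi * Complex.sinh ζ) = Complex.exp (psi ζ) - 1 := by
    rw [exp_psi hζ]; ring
  rw [h5] at h4
  have h6 : Complex.exp (psi ζ) * Complex.exp (-psi ζ) = 1 := by rw [← Complex.exp_add]; simp
  linear_combination Complex.exp (-psi ζ) * h4 +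
    (Real.pi * Complex.cosh ζ - deriv psi ζ) * h6

theorem norm_cosh_le (ζ : ℂ) : ‖Complex.cosh ζ‖ ≤ Real.cosh ζ.re := by
  rw [Complex.cosh, Real.cosh_eq, norm_div, Complex.norm_two]
  gcongr
  refine (norm_add_le _ _).trans_eq ?_
  rw [Complex.norm_exp, Complex.norm_exp, Complex.neg_re]

theorem norm_E3 (α β : ℝ) (z : ℂ) :
    ‖E3 α β z‖ = (‖1 + z‖ / ‖z‖) ^ (1 - α) * ‖Complex.exp (-z)‖ ^ β := by
  rw [E3, norm_mul, Complex.norm_cpow_real, norm_div, Complex.norm_exp, Complex.norm_exp,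
    ← Real.exp_mul, ← neg_sub 1 α, Real.rpow_neg (by positivity), ← Real.inv_rpow (by positivity),
    inv_div]
  simp [mul_comm]

/-- The factor `q = |1 - exp (-ψ)|` of `|ψ'|` is split as `q ^ (1 - α) * q ^ α`: the first power
cancels the singularity of `E3` at the cost of `κ ^ (1 - α)`, the second supplies the decay at `-∞`.
Leaving `κ` free allows a better constant on the real line than on the strip. -/
theorem norm_comp_psi_mul_deriv_le {d K α β κ A B : ℝ} (hd : d < Real.pi / 2)
    (hK : 0 < K) (hα : 0 < α) (hα1 : α ≤ 1) (hβ : 0 < β) {f : ℂ → ℂ}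
    (hbound : ∀ z ∈ psi '' strip d, ‖f z‖ ≤ K * ‖E3 α β z‖) {ζ : ℂ} (hζ : ζ ∈ strip d)
    (h1 : ‖1 + psi ζ‖ * ‖1 - Complex.exp (-psi ζ)‖ ≤ κ * ‖psi ζ‖)
    (h2 : ‖1 - Complex.exp (-psi ζ)‖ ≤ A) (h3 : ‖Complex.exp (-psi ζ)‖ ≤ B) :
    ‖f (psi ζ) * deriv psi ζ‖ ≤
      K * κ ^ (1 - α) * (A ^ α * B ^ β) * (Real.pi * Real.cosh ζ.re) := by
  have hζ2 : ζ ∈ strip (Real.pi / 2) := strip_mono hd.le hζ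
  have hZ : 0 < ‖psi ζ‖ := norm_pos_iff.2 (psi_ne_zero hζ2)
  have hf := hbound _ ⟨ζ, hζ, rfl⟩
  rw [norm_E3] at hf
  have hq : 0 < ‖1 - Complex.exp (-psi ζ)‖ := by
    rw [one_sub_exp_neg_psi hζ2, norm_pos_iff]
    simpa using one_add_exp_pi_sinh_ne_zero (neg_mem_strip hζ2)
  have hκ : 0 ≤ κ := by
    by_contra hcon
    push Not at hcon
    nlinarith [mul_nonneg (norm_nonneg (1 + psi ζ)) hq.le, mul_neg_of_neg_of_pos hcon hZ]
  rw [norm_mul, deriv_psi hζ2, norm_mul, norm_mul, Complex.norm_real, Real.norm_eq_abs,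
    abs_of_pos Real.pi_pos]
  set q := ‖1 - Complex.exp (-psi ζ)‖
  set r := ‖1 + psi ζ‖ / ‖psi ζ‖
  set p := ‖Complex.exp (-psi ζ)‖
  have hr : r * q ≤ κ := by
    rw [div_mul_eq_mul_div, div_le_iff₀ hZ]; exact h1
  have hr0 : 0 ≤ r := by positivity
  have hqq : q = q ^ (1 - α) * q ^ α := by
    rw [← Real.rpow_add hq]; simp
  calc ‖f (psi ζ)‖ * (Real.pi * ‖Complex.cosh ζ‖ * q)
      ≤ (K * (r ^ (1 - α) * p ^ β)) * (Real.pi * Real.cosh ζ.re * (q ^ (1 - α) * q ^ α)) := by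
        rw [← hqq]
        gcongr
        exact norm_cosh_le ζ
    _ = K * (r * q) ^ (1 - α) * (q ^ α * p ^ β) * (Real.pi * Real.cosh ζ.re) := by
        rw [Real.mul_rpow hr0 hq.le]; ring
    _ ≤ _ := by
        have hA : 0 ≤ A := hq.le.trans h2
        have : 0 ≤ Real.cosh ζ.re := (Real.cosh_pos _).le
        have : (0 : ℝ) ≤ 1 - α := by linarith
        have : 0 ≤ r * q := by positivity
        have := Real.pi_pos
        gcongr

/-- The cut is at `ρ = log (1 + c)`, where `exp ρ - 1 = c`. For `|z| ≥ ρ`, `1 + |z| ≤ (1 + ρ) / ρ *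
|z|`; for `|z| ≤ ρ`, convexity of `exp` gives `exp |z| - 1 ≤ c |z| / ρ`. Both cases yield the same
constant, which is the origin of `cTilde`. -/
theorem norm_one_add_mul_norm_one_sub_exp_neg_le {c : ℝ} (hc : 0 < c) {z : ℂ}
    (h : ‖1 - Complex.exp (-z)‖ ≤ c) :
    ‖1 + z‖ * ‖1 - Complex.exp (-z)‖ ≤
      (1 + Real.log (1 + c)) / Real.log (1 + c) * c * ‖z‖ := by
  have hρ : 0 < Real.log (1 + c) := Real.log_pos (by linarith)
  have hexp : Real.exp (Real.log (1 + c)) = 1 + c := Real.exp_log (by linarith)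
  set ρ := Real.log (1 + c)
  have h1 : ‖1 + z‖ ≤ 1 + ‖z‖ := (norm_add_le _ _).trans_eq (by simp)
  have hz : 0 ≤ ‖z‖ := norm_nonneg z
  rcases le_total ρ ‖z‖ with hle | hle
  · have h2 : 1 + ‖z‖ ≤ (1 + ρ) / ρ * ‖z‖ := by
      rw [div_mul_eq_mul_div, le_div_iff₀ hρ]
      nlinarith
    calc ‖1 + z‖ * ‖1 - Complex.exp (-z)‖ ≤ ((1 + ρ) / ρ * ‖z‖) * c :=
          mul_le_mul (h1.trans h2) h (norm_nonneg _) (by positivity)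
      _ = _ := by ring
  · have h2 : ‖1 - Complex.exp (-z)‖ ≤ Real.exp ‖z‖ - 1 := by
      have := Complex.norm_exp_sub_sum_le_exp_norm_sub_sum (-z) 1
      rw [← norm_neg]
      simpa using this
    have h3 : Real.exp ‖z‖ - 1 ≤ ‖z‖ / ρ * c := by
      have := convexOn_exp.2 (Set.mem_univ 0) (Set.mem_univ ρ)
        (sub_nonneg.2 ((div_le_one hρ).2 hle)) (div_nonneg hz hρ.le) (by ring)
      simp only [smul_eq_mul, mul_zero, zero_add, Real.exp_zero, mul_one, hexp] at this
      rw [div_mul_cancel₀ _ hρ.ne'] at this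
      linarith
    calc ‖1 + z‖ * ‖1 - Complex.exp (-z)‖ ≤ (1 + ρ) * (‖z‖ / ρ * c) :=
          mul_le_mul (by linarith) (h2.trans h3) (norm_nonneg _) (by positivity)
      _ = _ := by ring

theorem inv_one_add_exp_rpow_le {γ : ℝ} (hγ : 0 < γ) (t : ℝ) :
    (1 + Real.exp t)⁻¹ ^ γ ≤ Real.exp (-(γ * t)) := by
  have : (1 + Real.exp t)⁻¹ ≤ Real.exp (-t) := by
    rw [Real.exp_neg]
    gcongr
    linarith
  calc (1 + Real.exp t)⁻¹ ^ γ ≤ Real.exp (-t) ^ γ := by gcongr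
    _ = Real.exp (-(γ * t)) := by rw [← Real.exp_mul]; ring_nf

theorem inv_one_add_exp_rpow_le_one {γ : ℝ} (hγ : 0 < γ) (t : ℝ) :
    (1 + Real.exp t)⁻¹ ^ γ ≤ 1 := by
  refine Real.rpow_le_one (by positivity) (inv_le_one_of_one_le₀ ?_) hγ.le
  linarith [Real.exp_pos t]

theorem inv_rpow_mul_inv_rpow_le_right {α β : ℝ} (hα : 0 < α) (hβ : 0 < β) (s : ℝ) :
    (1 + Real.exp (-s))⁻¹ ^ α * (1 + Real.exp s)⁻¹ ^ β ≤ Real.exp (-(β * s)) := by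
  have := mul_le_mul (inv_one_add_exp_rpow_le_one hα (-s)) (inv_one_add_exp_rpow_le hβ s)
    (by positivity) zero_le_one
  rwa [one_mul] at this

theorem inv_rpow_mul_inv_rpow_le_left {α β : ℝ} (hα : 0 < α) (hβ : 0 < β) (s : ℝ) :
    (1 + Real.exp (-s))⁻¹ ^ α * (1 + Real.exp s)⁻¹ ^ β ≤ Real.exp (α * s) := by
  have := inv_rpow_mul_inv_rpow_le_right hβ hα (-s)
  rwa [neg_neg, mul_neg, neg_neg, mul_comm] at this

theorem inv_rpow_mul_inv_rpow_le {α β : ℝ} (hα : 0 < α) (hβ : 0 < β) (s : ℝ) :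
    (1 + Real.exp (-s))⁻¹ ^ α * (1 + Real.exp s)⁻¹ ^ β ≤ Real.exp (-(min α β * |s|)) := by
  rcases le_total 0 s with h | h
  · refine (inv_rpow_mul_inv_rpow_le_right hα hβ s).trans ?_
    rw [abs_of_nonneg h]
    gcongr
    exact min_le_right _ _
  · refine (inv_rpow_mul_inv_rpow_le_left hα hβ s).trans ?_
    rw [abs_of_nonpos h, mul_neg, neg_neg, Real.exp_le_exp]
    exact mul_le_mul_of_nonpos_right (min_le_left _ _) h

theorem norm_exp_neg_psi_le {d : ℝ} (hd0 : 0 < d) (hd : d < Real.pi / 2) {ζ : ℂ}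
    (hζ : ζ ∈ strip d) :
    ‖Complex.exp (-psi ζ)‖ ≤
      (1 + Real.exp (Real.pi * (Real.sinh ζ.re * Real.cos ζ.im)))⁻¹ *
        (Real.cos (Real.pi / 2 * Real.sin d))⁻¹ := by
  have hc := cos_pi_div_two_mul_sin_pos hd0 hd
  rw [exp_neg_psi (strip_mono hd.le hζ), norm_inv, ← mul_inv]
  gcongr
  exact one_add_exp_mul_cos_le_norm hd0 hd hζ

theorem norm_one_sub_exp_neg_psi_le {d : ℝ} (hd0 : 0 < d) (hd : d < Real.pi / 2) {ζ : ℂ}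
    (hζ : ζ ∈ strip d) :
    ‖1 - Complex.exp (-psi ζ)‖ ≤
      (1 + Real.exp (-(Real.pi * (Real.sinh ζ.re * Real.cos ζ.im))))⁻¹ *
        (Real.cos (Real.pi / 2 * Real.sin d))⁻¹ := by
  have hc := cos_pi_div_two_mul_sin_pos hd0 hd
  rw [one_sub_exp_neg_psi (strip_mono hd.le hζ), norm_inv, ← mul_inv]
  gcongr
  exact one_add_exp_neg_mul_cos_le_norm hd0 hd hζ

theorem norm_one_sub_exp_neg_psi_le_cConst {d : ℝ} (hd0 : 0 < d) (hd : d < Real.pi / 2) {ζ : ℂ}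
    (hζ : ζ ∈ strip d) : ‖1 - Complex.exp (-psi ζ)‖ ≤ cConst d := by
  have hc := cos_pi_div_two_mul_sin_pos hd0 hd
  refine (norm_sub_le _ _).trans ?_
  rw [cConst, norm_one]
  gcongr
  refine (norm_exp_neg_psi_le hd0 hd hζ).trans ?_
  rw [one_div]
  refine mul_le_of_le_one_left (by positivity) (inv_le_one_of_one_le₀ ?_)
  linarith [Real.exp_pos (Real.pi * (Real.sinh ζ.re * Real.cos ζ.im))]

/-- The majorant `π cosh x exp (-b |sinh x|)` of the transformed integrand. -/
noncomputable def deMajorant (b x : ℝ) : ℝ :=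
  Real.pi * Real.cosh x * Real.exp (-(b * |Real.sinh x|))

theorem norm_integrand_le {d K α β : ℝ} (hd0 : 0 < d) (hd : d < Real.pi / 2)
    (hK : 0 < K) (hα : 0 < α) (hα1 : α ≤ 1) (hβ : 0 < β) {f : ℂ → ℂ}
    (hbound : ∀ z ∈ psi '' strip d, ‖f z‖ ≤ K * ‖E3 α β z‖) {ζ : ℂ} (hζ : ζ ∈ strip d) :
    ‖f (psi ζ) * deriv psi ζ‖ ≤
      K * cTilde d ^ (1 - α) / Real.cos (Real.pi / 2 * Real.sin d) ^ (α + β) *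
        deMajorant (Real.pi * min α β * Real.cos d) ζ.re := by
  have hc := cos_pi_div_two_mul_sin_pos hd0 hd
  have hpi := Real.pi_pos
  have hcc : 0 < cConst d := by unfold cConst; positivity
  have hct : 0 < cTilde d := by
    have := Real.log_pos (by linarith : 1 < 1 + cConst d)
    unfold cTilde; positivity
  have hμ : 0 < min α β := lt_min hα hβ
  refine (norm_comp_psi_mul_deriv_le hd hK hα hα1 hβ hbound hζ
    (norm_one_add_mul_norm_one_sub_exp_neg_le hcc (norm_one_sub_exp_neg_psi_le_cConst hd0 hd hζ))
    (norm_one_sub_exp_neg_psi_le hd0 hd hζ) (norm_exp_neg_psi_le hd0 hd hζ)).trans ?_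
  have hcos : Real.cos d ≤ Real.cos ζ.im := by
    rw [← Real.cos_abs ζ.im]
    exact Real.cos_le_cos_of_nonneg_of_le_pi (abs_nonneg _) (by linarith)
      (le_of_lt (show |ζ.im| < d from hζ))
  have hcosd : 0 < Real.cos d := Real.cos_pos_of_mem_Ioo ⟨by linarith, hd⟩
  set s := Real.pi * (Real.sinh ζ.re * Real.cos ζ.im) with hs
  set c := Real.cos (Real.pi / 2 * Real.sin d)
  have h1 : ((1 + Real.exp (-s))⁻¹ * c⁻¹) ^ α * ((1 + Real.exp s)⁻¹ * c⁻¹) ^ β ≤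
      (c ^ (α + β))⁻¹ * Real.exp (-(Real.pi * min α β * Real.cos d * |Real.sinh ζ.re|)) := by
    rw [Real.mul_rpow (by positivity) (by positivity), Real.mul_rpow (by positivity) (by positivity),
      ← Real.inv_rpow hc.le, Real.rpow_add (by positivity)]
    have h2 := inv_rpow_mul_inv_rpow_le hα hβ s
    have h3 : Real.exp (-(min α β * |s|)) ≤
        Real.exp (-(Real.pi * min α β * Real.cos d * |Real.sinh ζ.re|)) := by
      rw [hs, abs_mul, abs_mul, abs_of_pos hpi, abs_of_pos (hcosd.trans_le hcos)]
      refine Real.exp_le_exp.2 (neg_le_neg ?_)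
      calc _ = min α β * (Real.pi * (|Real.sinh ζ.re| * Real.cos d)) := by ring
        _ ≤ _ := by gcongr
    calc _ = c⁻¹ ^ α * c⁻¹ ^ β * ((1 + Real.exp (-s))⁻¹ ^ α * (1 + Real.exp s)⁻¹ ^ β) := by ring
      _ ≤ _ := mul_le_mul_of_nonneg_left (h2.trans h3) (by positivity)
  calc _ ≤ K * cTilde d ^ (1 - α) * ((c ^ (α + β))⁻¹ *
        Real.exp (-(Real.pi * min α β * Real.cos d * |Real.sinh ζ.re|))) *
          (Real.pi * Real.cosh ζ.re) := by
        have := (Real.cosh_pos ζ.re).le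
        unfold cTilde at hct ⊢
        gcongr
    _ = _ := by rw [deMajorant]; ring

/-- On the real line the transformed integrand is bounded with the constant `κ` of the bound
`(1 + u) (1 - exp (-u)) ≤ κ u`. -/
theorem norm_integrand_ofReal_le {d K α β κ : ℝ} (hd0 : 0 < d) (hd : d < Real.pi / 2)
    (hK : 0 < K) (hα : 0 < α) (hα1 : α ≤ 1) (hβ : 0 < β) {f : ℂ → ℂ}
    (hbound : ∀ z ∈ psi '' strip d, ‖f z‖ ≤ K * ‖E3 α β z‖)
    (hκ : ∀ u : ℝ, 0 < u → (1 + u) * (1 - Real.exp (-u)) ≤ κ * u) (x : ℝ) :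
    ‖f (psi x) * deriv psi x‖ ≤ K * κ ^ (1 - α) *
      ((1 + Real.exp (-(Real.pi * Real.sinh x)))⁻¹ ^ α *
        (1 + Real.exp (Real.pi * Real.sinh x))⁻¹ ^ β) * (Real.pi * Real.cosh x) := by
  have hx : (x : ℂ) ∈ strip d := by simpa [strip] using hd0
  have hx2 : (x : ℂ) ∈ strip (Real.pi / 2) := strip_mono hd.le hx
  have e : (Real.pi : ℂ) * Complex.sinh x = ((Real.pi * Real.sinh x : ℝ) : ℂ) := by push_cast; rfl
  refine norm_comp_psi_mul_deriv_le hd hK hα hα1 hβ hbound hx ?_ ?_ ?_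
  · rw [psi_ofReal]
    have hu : 0 < Real.log (1 + Real.exp (Real.pi * Real.sinh x)) :=
      Real.log_pos (by linarith [Real.exp_pos (Real.pi * Real.sinh x)])
    set u := Real.log (1 + Real.exp (Real.pi * Real.sinh x))
    have h := hκ u hu
    have h1 : ‖(1 : ℂ) + u‖ = 1 + u := by
      rw [← Complex.ofReal_one, ← Complex.ofReal_add, Complex.norm_real, Real.norm_eq_abs,
        abs_of_pos (by linarith)]
    have h2 : ‖(1 : ℂ) - Complex.exp (-u)‖ = 1 - Real.exp (-u) := by
      have h3 : Real.exp (-u) ≤ 1 := by simpa using hu.le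
      rw [← Complex.ofReal_neg, ← Complex.ofReal_exp, ← Complex.ofReal_one, ← Complex.ofReal_sub,
        Complex.norm_real, Real.norm_eq_abs, abs_of_nonneg (by linarith)]
    rw [h1, h2, Complex.norm_real, Real.norm_eq_abs, abs_of_pos hu]
    exact h
  · rw [one_sub_exp_neg_psi hx2, e, ← Complex.ofReal_neg, ← Complex.ofReal_exp,
      ← Complex.ofReal_one, ← Complex.ofReal_add, ← Complex.ofReal_inv, Complex.norm_real,
      Real.norm_eq_abs, abs_of_pos (by positivity)]
  · rw [exp_neg_psi hx2, e, ← Complex.ofReal_exp,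
      ← Complex.ofReal_one, ← Complex.ofReal_add, ← Complex.ofReal_inv, Complex.norm_real,
      Real.norm_eq_abs, abs_of_pos (by positivity)]

theorem differentiableOn_integrand {d : ℝ} (hd : d < Real.pi / 2) {f : ℂ → ℂ}
    (hf : AnalyticOnNhd ℂ f (psi '' strip d)) :
    DifferentiableOn ℂ (fun ζ => f (psi ζ) * deriv psi ζ) (strip d) := by
  have h1 : DifferentiableOn ℂ psi (strip d) := differentiableOn_psi.mono (strip_mono hd.le)
  refine DifferentiableOn.mul ?_ (h1.deriv (isOpen_strip d))
  exact hf.differentiableOn.comp h1 (Set.mapsTo_image _ _)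

end SincDE

/-! ### Discretization error: contour shift and Poisson summation -/

namespace SincDE

open MeasureTheory Filter Topology
open scoped Real FourierTransform

theorem mem_strip_add_mul_I {δ η : ℝ} (x : ℝ) (hη : |η| < δ) :
    (x : ℂ) + η * Complex.I ∈ strip δ := by
  simpa [strip] using hη

theorem tendsto_const_mul_inv_one_add_sq_atTop (C : ℝ) :
    Tendsto (fun R : ℝ => C * (1 + R ^ 2)⁻¹) atTop (𝓝 0) := by
  have h : Tendsto (fun R : ℝ => 1 + R ^ 2) atTop atTop :=
    tendsto_atTop_add_const_left _ _ (tendsto_pow_atTop two_ne_zero)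
  simpa using h.inv_tendsto_atTop.const_mul C

/-- Shift of the line of integration inside a horizontal strip. -/
theorem integral_shift_eq {δ η C : ℝ} (hη : |η| < δ) {Q : ℂ → ℂ}
    (hQ : DifferentiableOn ℂ Q (strip δ))
    (hC : ∀ x y : ℝ, |y| ≤ |η| → ‖Q (x + y * Complex.I)‖ ≤ C * (1 + x ^ 2)⁻¹) :
    ∫ x : ℝ, Q x = ∫ x : ℝ, Q (x + η * Complex.I) := by
  have hcont : ∀ y : ℝ, |y| ≤ |η| → Continuous fun x : ℝ => Q (x + y * Complex.I) := by
    intro y hy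
    refine hQ.continuousOn.comp_continuous (by fun_prop)
      fun x => mem_strip_add_mul_I x (hy.trans_lt hη)
  have hint : ∀ y : ℝ, |y| ≤ |η| → Integrable fun x : ℝ => Q (x + y * Complex.I) := by
    intro y hy
    refine (integrable_inv_one_add_sq.const_mul C).mono' (hcont y hy).aestronglyMeasurable ?_
    exact Eventually.of_forall fun x => hC x y hy
  have hrect : ∀ R : ℝ, (∫ x in (-R)..R, Q x) - (∫ x in (-R)..R, Q (x + η * Complex.I)) =
      Complex.I * (∫ y in (0 : ℝ)..η, Q ((-R : ℝ) + y * Complex.I)) -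
        Complex.I * ∫ y in (0 : ℝ)..η, Q (R + y * Complex.I) := by
    intro R
    have h := Complex.integral_boundary_rect_eq_zero_of_differentiableOn Q (-R : ℝ)
      (R + η * Complex.I) (hQ.mono ?_)
    · simp only [Complex.ofReal_im, Complex.ofReal_re, Complex.add_re, Complex.add_im,
        Complex.mul_re, Complex.mul_im, Complex.I_re, Complex.I_im, Complex.ofReal_zero, zero_mul,
        add_zero, mul_zero, mul_one, sub_zero, zero_add, smul_eq_mul] at h
      linear_combination h
    · intro z hz
      have hz2 : z.im ∈ Set.uIcc (0 : ℝ) η := by simpa using hz.2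
      have : |z.im| ≤ |η| := by
        have := Set.abs_sub_left_of_mem_uIcc hz2
        simpa using this
      exact this.trans_lt hη
  have hvert : ∀ y : ℝ, y ∈ Set.uIoc (0 : ℝ) η → |y| ≤ |η| := by
    intro y hy
    have := Set.abs_sub_left_of_mem_uIcc (Set.uIoc_subset_uIcc hy)
    simpa using this
  -- The sign `ε = ±1` covers both vertical sides of the rectangle.
  have hside : ∀ ε : ℝ, ε ^ 2 = 1 → Tendsto (fun R : ℝ =>
      Complex.I * ∫ y in (0 : ℝ)..η, Q ((ε * R : ℝ) + y * Complex.I)) atTop (𝓝 0) := by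
    intro ε hε
    refine squeeze_zero_norm (a := fun R => C * |η - 0| * (1 + R ^ 2)⁻¹) ?_
      (tendsto_const_mul_inv_one_add_sq_atTop _)
    intro R
    rw [norm_mul, Complex.norm_I, one_mul]
    refine (intervalIntegral.norm_integral_le_of_norm_le_const (C := C * (1 + R ^ 2)⁻¹)
      fun y hy => ?_).trans_eq (by ring)
    refine (hC _ y (hvert y hy)).trans_eq ?_
    rw [mul_pow, hε, one_mul]
  have hlim1 := (intervalIntegral_tendsto_integral (hint 0 (by simp)) tendsto_neg_atTop_atBot
    tendsto_id).sub
    (intervalIntegral_tendsto_integral (hint η le_rfl) tendsto_neg_atTop_atBot tendsto_id)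
  have hlim2 := (hside (-1) (by norm_num)).sub (hside 1 (by norm_num))
  have heq := tendsto_nhds_unique hlim1 (hlim2.congr fun R => ?_)
  · simp only [sub_zero, Complex.ofReal_zero, zero_mul, add_zero] at heq
    exact sub_eq_zero.1 heq
  · simpa using (hrect R).symm

/-- The line is moved to the side on which the Fourier kernel decays, chosen by the sign of `ξ`. As
`φ` is controlled only in the open strip, the shift is by `δ' < δ`, followed by `δ' → δ`. The
majorant depends on `Re z` only, so the same integral serves every `δ'`. -/
theorem norm_fourier_le {δ C : ℝ} (hδ : 0 < δ) {φ : ℂ → ℂ} {P : ℝ → ℝ}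
    (hφ : DifferentiableOn ℂ φ (strip δ)) (hP : Continuous P)
    (hφP : ∀ z ∈ strip δ, ‖φ z‖ ≤ P z.re) (hC : ∀ x, P x ≤ C * (1 + x ^ 2)⁻¹) (ξ : ℝ) :
    ‖𝓕 (fun x : ℝ => φ x) ξ‖ ≤ Real.exp (-(2 * π * |ξ| * δ)) * ∫ x, P x := by
  have hP0 : ∀ x, 0 ≤ P x := fun x => (norm_nonneg _).trans
    ((hφP x (by simpa [strip] using hδ)).trans_eq (by simp))
  have hPint : Integrable P := by
    refine (integrable_inv_one_add_sq.const_mul C).mono' hP.aestronglyMeasurable ?_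
    exact Eventually.of_forall fun x => by
      rw [Real.norm_eq_abs, abs_of_nonneg (hP0 x)]; exact hC x
  have key : ∀ δ', δ' ∈ Set.Ioo 0 δ →
      ‖𝓕 (fun x : ℝ => φ x) ξ‖ ≤ Real.exp (-(2 * π * |ξ| * δ')) * ∫ x, P x := by
    rintro δ' ⟨h0, h1⟩
    obtain ⟨σ, hσ, hσξ⟩ : ∃ σ : ℝ, |σ| = 1 ∧ ξ * σ = |ξ| := by
      rcases le_total 0 ξ with h | h
      · exact ⟨1, by simp, by rw [abs_of_nonneg h, mul_one]⟩
      · exact ⟨-1, by simp, by rw [abs_of_nonpos h]; ring⟩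
    set η : ℝ := -(σ * δ') with hη
    have hηabs : |η| = δ' := by rw [hη, abs_neg, abs_mul, hσ, one_mul, abs_of_pos h0]
    let Q : ℂ → ℂ := fun z => Complex.exp (-2 * π * z * ξ * Complex.I) * φ z
    have hQn : ∀ x y : ℝ, ‖Complex.exp (-2 * π * (x + y * Complex.I) * ξ * Complex.I)‖ =
        Real.exp (2 * π * ξ * y) := by
      intro x y
      rw [Complex.norm_exp]
      congr 1
      simp
      ring
    have hshift := integral_shift_eq (δ := δ) (η := η)
      (C := Real.exp (2 * π * |ξ| * δ') * C) (Q := Q) (by rw [hηabs]; exact h1)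
      (by refine DifferentiableOn.mul ?_ hφ; fun_prop) (by
        intro x y hy
        rw [norm_mul, hQn, mul_assoc (Real.exp _) C]
        have h2 := (hφP _ (mem_strip_add_mul_I x (hy.trans_lt (hηabs.trans_lt h1)))).trans (hC _)
        have h3 : ξ * y ≤ |ξ| * δ' := by
          rw [hηabs] at hy
          calc ξ * y ≤ |ξ * y| := le_abs_self _
            _ = |ξ| * |y| := abs_mul _ _
            _ ≤ _ := by gcongr
        refine mul_le_mul (Real.exp_le_exp.2 ?_) (h2.trans_eq (by simp)) (norm_nonneg _)
          (Real.exp_pos _).le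
        have := Real.pi_pos
        nlinarith)
    have hF : 𝓕 (fun x : ℝ => φ x) ξ = ∫ x : ℝ, Q x := by
      rw [Real.fourier_real_eq_integral_exp_smul]
      congr 1 with x
      simp [Q]
    rw [hF, hshift, ← integral_const_mul]
    refine norm_integral_le_of_norm_le (hPint.const_mul _) (Eventually.of_forall fun x => ?_)
    have h2 := hφP _ (mem_strip_add_mul_I x (hηabs.trans_lt h1))
    rw [norm_mul, hQn]
    refine mul_le_mul (Real.exp_le_exp.2 (le_of_eq ?_)) (h2.trans_eq (by simp)) (norm_nonneg _)
      (Real.exp_pos _).le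
    rw [← hσξ, hη]; ring
  have hlim : Tendsto (fun δ' => Real.exp (-(2 * π * |ξ| * δ')) * ∫ x, P x) (𝓝[<] δ)
      (𝓝 (Real.exp (-(2 * π * |ξ| * δ)) * ∫ x, P x)) := by
    refine Tendsto.mono_left (Continuous.tendsto ?_ δ) nhdsWithin_le_nhds
    fun_prop
  refine ge_of_tendsto hlim ?_
  filter_upwards [Ioo_mem_nhdsLT hδ] with δ' h using key δ' h

theorem isBigO_rpow_of_le_inv_one_add_sq {C : ℝ} {φ : ℝ → ℂ}
    (hC : ∀ x, ‖φ x‖ ≤ C * (1 + x ^ 2)⁻¹) :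
    φ =O[cocompact ℝ] (fun x : ℝ => |x| ^ (-2 : ℝ)) := by
  refine IsBigO.of_bound C ?_
  have h0 : ∀ᶠ x : ℝ in cocompact ℝ, x ≠ 0 := by
    have : ({0} : Set ℝ)ᶜ ∈ cocompact ℝ := isCompact_singleton.compl_mem_cocompact
    filter_upwards [this] with x hx using hx
  filter_upwards [h0] with x hx
  have hC0 : 0 ≤ C := by
    have := (norm_nonneg _).trans (hC 0)
    simpa using this
  refine (hC x).trans ?_
  rw [Real.rpow_neg (abs_nonneg x), Real.rpow_two, sq_abs, norm_inv, Real.norm_eq_abs,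
    abs_of_nonneg (sq_nonneg x)]
  have : 0 < x ^ 2 := by positivity
  gcongr
  linarith

/-- The discretization error of the trapezoidal rule with unit step. -/
theorem norm_integral_sub_tsum_le {δ C : ℝ} (hδ : 0 < δ) {φ : ℂ → ℂ} {P : ℝ → ℝ}
    (hφ : DifferentiableOn ℂ φ (strip δ)) (hP : Continuous P)
    (hφP : ∀ z ∈ strip δ, ‖φ z‖ ≤ P z.re) (hC : ∀ x, P x ≤ C * (1 + x ^ 2)⁻¹) :
    (Summable fun k : ℤ => φ k) ∧
    ‖(∫ x : ℝ, φ x) - ∑' k : ℤ, φ k‖ ≤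
      2 * (∫ x, P x) * (Real.exp (-(2 * π * δ)) / (1 - Real.exp (-(2 * π * δ)))) := by
  have hreal : ∀ x : ℝ, (x : ℂ) ∈ strip δ := fun x => by simpa [strip] using hδ
  have hcont : Continuous fun x : ℝ => φ x :=
    hφ.continuousOn.comp_continuous Complex.continuous_ofReal hreal
  have hdecay := isBigO_rpow_of_le_inv_one_add_sq (φ := fun x : ℝ => φ x)
    fun x => (hφP x (hreal x)).trans (hC x)
  have hsum : Summable fun k : ℤ => φ k := by
    have := summable_of_isBigO (Real.summable_abs_int_rpow one_lt_two)
      (hdecay.comp_tendsto Int.tendsto_coe_cofinite)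
    simpa [Function.comp_def] using this
  refine ⟨hsum, ?_⟩
  set r := Real.exp (-(2 * π * δ)) with hr
  have hr0 : 0 < r := Real.exp_pos _
  have hr1 : r < 1 := by
    rw [hr, Real.exp_lt_one_iff]
    have := Real.pi_pos
    have : 0 < 2 * π * δ := by positivity
    linarith
  set J := ∫ x, P x
  set a : ℤ → ℂ := fun n => 𝓕 (fun x : ℝ => φ x) (n : ℝ) with ha
  have hpow : ∀ n : ℕ, Real.exp (-(2 * π * ((n : ℝ) + 1) * δ)) = r ^ (n + 1) := by
    intro n
    rw [hr, ← Real.exp_nat_mul]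
    push_cast
    ring_nf
  have hpos : ∀ n : ℕ, ‖a ((n : ℤ) + 1)‖ ≤ J * r ^ (n + 1) := by
    intro n
    refine (norm_fourier_le hδ hφ hP hφP hC _).trans_eq ?_
    push_cast
    rw [abs_of_nonneg (by positivity : (0 : ℝ) ≤ (n : ℝ) + 1), hpow, mul_comm]
  have hneg : ∀ n : ℕ, ‖a (-((n : ℤ) + 1))‖ ≤ J * r ^ (n + 1) := by
    intro n
    refine (norm_fourier_le hδ hφ hP hφP hC _).trans_eq ?_
    push_cast
    rw [abs_neg, abs_of_nonneg (by positivity : (0 : ℝ) ≤ (n : ℝ) + 1), hpow, mul_comm]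
  have hgeo : HasSum (fun n : ℕ => J * r ^ (n + 1)) (J * (r / (1 - r))) := by
    have := (hasSum_geometric_of_lt_one hr0.le hr1).mul_left (J * r)
    convert! this using 1
    · ext n; ring
    · ring
  have hs1 : Summable fun n : ℕ => a ((n : ℤ) + 1) := hgeo.summable.of_norm_bounded hpos
  have hs2 : Summable fun n : ℕ => a (-((n : ℤ) + 1)) := hgeo.summable.of_norm_bounded hneg
  have hs1' : Summable fun n : ℕ => a n := by
    rw [← summable_nat_add_iff 1]
    simpa using hs1
  have hsa : Summable a := Summable.of_nat_of_neg_add_one hs1' hs2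
  -- The coefficient at `0` is the integral itself, so the error is the sum over the nonzero
  -- frequencies: two geometric series.
  have hpoisson : ∑' k : ℤ, φ k = ∑' n : ℤ, a n := by
    have := Real.tsum_eq_tsum_fourier_of_rpow_decay_of_summable hcont one_lt_two hdecay hsa 0
    simpa using this
  have ha0 : a 0 = ∫ x : ℝ, φ x := by
    simp only [ha]
    rw [Real.fourier_real_eq_integral_exp_smul]
    simp
  rw [hpoisson, tsum_of_nat_of_neg_add_one hs1' hs2, hs1'.tsum_eq_zero_add]
  simp only [Nat.cast_zero, Nat.cast_add, Nat.cast_one]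
  rw [ha0, show (∫ x : ℝ, φ x) - ((∫ x : ℝ, φ x) + ∑' n : ℕ, a ((n : ℤ) + 1) +
    ∑' n : ℕ, a (-((n : ℤ) + 1))) = -(∑' n : ℕ, a ((n : ℤ) + 1) +
      ∑' n : ℕ, a (-((n : ℤ) + 1))) by ring, norm_neg]
  refine (norm_add_le _ _).trans ?_
  have h1 := tsum_of_norm_bounded hgeo hpos
  have h2 := tsum_of_norm_bounded hgeo hneg
  linarith

/-- The discretization error of the trapezoidal rule with step `h`. -/
theorem norm_integral_sub_mul_tsum_le {d h C : ℝ} (hd : 0 < d) (hh : 0 < h) {g : ℂ → ℂ} {P : ℝ → ℝ}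
    (hg : DifferentiableOn ℂ g (strip d)) (hP : Continuous P)
    (hgP : ∀ z ∈ strip d, ‖g z‖ ≤ P z.re) (hC : ∀ x, P x ≤ C * (1 + x ^ 2)⁻¹) :
    (Summable fun k : ℤ => g ((k * h : ℝ) : ℂ)) ∧
    ‖(∫ x : ℝ, g x) - h * ∑' k : ℤ, g ((k * h : ℝ) : ℂ)‖ ≤
      2 * (∫ x, P x) * (Real.exp (-(2 * π * d / h)) / (1 - Real.exp (-(2 * π * d / h)))) := by
  have hmaps : ∀ z ∈ strip (d / h), z * h ∈ strip d := by
    intro z hz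
    have hz' : |z.im| < d / h := hz
    rw [lt_div_iff₀ hh] at hz'
    simpa [strip, abs_mul, abs_of_pos hh] using hz'
  have hC0 : 0 ≤ C := by
    have h1 : 0 ≤ P 0 := (norm_nonneg _).trans
      ((hgP (0 : ℝ) (by simpa [strip] using hd)).trans_eq (by simp))
    simpa using h1.trans (hC 0)
  -- Rescaling to unit step makes the half-width `d / h`. The new decay constant comes from `1 + x²
  -- ≤ (1 + h⁻²) (1 + (x h)²)`.
  obtain ⟨h1, h2⟩ := norm_integral_sub_tsum_le (δ := d / h) (C := C * (1 + (h⁻¹) ^ 2))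
    (φ := fun z => g (z * h)) (P := fun x => P (x * h)) (div_pos hd hh)
    (hg.comp (by fun_prop) hmaps) (by fun_prop)
    (fun z hz => (hgP _ (hmaps z hz)).trans_eq (by simp))
    (fun x => (hC _).trans (by
      rw [mul_assoc]
      refine mul_le_mul_of_nonneg_left ?_ hC0
      rw [← div_eq_mul_inv, inv_eq_one_div, div_le_div_iff₀ (by positivity) (by positivity)]
      have e : h⁻¹ ^ 2 * h ^ 2 = 1 := by rw [← mul_pow, inv_mul_cancel₀ hh.ne', one_pow]
      nlinarith [sq_nonneg (x * h), sq_nonneg (h⁻¹), sq_nonneg x]))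
  simp only [Complex.ofReal_mul, Complex.ofReal_intCast]
  refine ⟨h1, ?_⟩
  have e1 : ∫ x : ℝ, g (x * h) = (h⁻¹ : ℂ) * ∫ x : ℝ, g x := by
    have := Measure.integral_comp_mul_right (fun x : ℝ => g x) h
    simp only [Complex.ofReal_mul] at this
    rw [this, abs_of_pos (inv_pos.2 hh), Complex.real_smul, Complex.ofReal_inv]
  have e2 : ∫ x : ℝ, P (x * h) = h⁻¹ * ∫ x : ℝ, P x := by
    rw [Measure.integral_comp_mul_right P h, abs_of_pos (inv_pos.2 hh), smul_eq_mul]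
  rw [e1, e2] at h2
  have hhC : (h : ℂ) ≠ 0 := by exact_mod_cast hh.ne'
  have e3 : (∫ x : ℝ, g x) - h * ∑' k : ℤ, g (k * h) =
      h * ((h⁻¹ : ℂ) * (∫ x : ℝ, g x) - ∑' k : ℤ, g (k * h)) := by
    field_simp
  rw [e3, norm_mul, Complex.norm_real, Real.norm_eq_abs, abs_of_pos hh]
  refine (mul_le_mul_of_nonneg_left h2 hh.le).trans_eq ?_
  rw [show 2 * π * (d / h) = 2 * π * d / h by ring]
  field_simp

/-- Quadratic decay is all that the contour shift and Poisson summation require; the value of `C`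
never enters the error bound. -/
theorem exists_deMajorant_le {b : ℝ} (hb : 0 < b) :
    ∃ C, ∀ x, deMajorant b x ≤ C * (1 + x ^ 2)⁻¹ := by
  refine ⟨π * (1 + 1 / b + 2 / b ^ 2 + 6 / b ^ 3), fun x => ?_⟩
  set S := |Real.sinh x| with hS
  have hS0 : 0 ≤ S := abs_nonneg _
  have hxS : |x| ≤ S := by
    rcases le_total 0 x with h | h
    · rw [hS, abs_of_nonneg h, abs_of_nonneg (Real.sinh_nonneg_iff.2 h)]
      exact Real.self_le_sinh_iff.2 h
    · rw [hS, abs_of_nonpos h, abs_of_nonpos (Real.sinh_nonpos_iff.2 h)]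
      linarith [Real.sinh_le_self_iff.2 h]
  have hcosh : Real.cosh x ≤ 1 + S := by
    refine abs_le_of_sq_le_sq' ?_ (by positivity) |>.2
    rw [Real.cosh_sq, hS]
    nlinarith [sq_abs (Real.sinh x)]
  have hx2 : x ^ 2 ≤ S ^ 2 := by rw [← sq_abs x]; gcongr
  have hpi := Real.pi_pos
  have hE := Real.exp_pos (b * S)
  have hbS : 0 ≤ b * S := by positivity
  have p0 : 1 ≤ Real.exp (b * S) := Real.one_le_exp hbS
  have p1 : b * S ≤ Real.exp (b * S) := by linarith [Real.add_one_le_exp (b * S)]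
  have p2 : (b * S) ^ 2 / 2 ≤ Real.exp (b * S) := by
    simpa using Real.pow_div_factorial_le_exp (b * S) hbS 2
  have p3 : (b * S) ^ 3 / 6 ≤ Real.exp (b * S) := by
    simpa [Nat.factorial] using Real.pow_div_factorial_le_exp (b * S) hbS 3
  have q1 : S ≤ 1 / b * Real.exp (b * S) := by
    rw [div_mul_eq_mul_div, le_div_iff₀ hb]; linarith
  have q2 : S ^ 2 ≤ 2 / b ^ 2 * Real.exp (b * S) := by
    rw [div_mul_eq_mul_div, le_div_iff₀ (by positivity)]; linarith
  have q3 : S ^ 3 ≤ 6 / b ^ 3 * Real.exp (b * S) := by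
    rw [div_mul_eq_mul_div, le_div_iff₀ (by positivity)]; linarith
  have hmain : (1 + S) * (1 + x ^ 2) ≤
      (1 + 1 / b + 2 / b ^ 2 + 6 / b ^ 3) * Real.exp (b * S) := by
    calc (1 + S) * (1 + x ^ 2) ≤ (1 + S) * (1 + S ^ 2) := by gcongr
      _ = 1 + S + S ^ 2 + S ^ 3 := by ring
      _ ≤ _ := by nlinarith
  rw [deMajorant, ← hS, Real.exp_neg, ← div_eq_mul_inv, ← div_eq_mul_inv,
    div_le_div_iff₀ hE (by positivity)]
  calc π * Real.cosh x * (1 + x ^ 2) ≤ π * ((1 + S) * (1 + x ^ 2)) := by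
        rw [mul_assoc]; gcongr
    _ ≤ π * ((1 + 1 / b + 2 / b ^ 2 + 6 / b ^ 3) * Real.exp (b * S)) := by gcongr
    _ = _ := by ring

theorem continuous_deMajorant (b : ℝ) : Continuous (deMajorant b) := by
  unfold deMajorant
  have := Real.continuous_cosh
  have := Real.continuous_sinh
  fun_prop

theorem integral_deMajorant {b : ℝ} (hb : 0 < b) : ∫ x, deMajorant b x = 2 * π / b := by
  have hpi := Real.pi_pos
  let H : ℝ → ℝ := fun x => π * Real.cosh x * Real.exp (-(b * Real.sinh x))
  have h1 : ∀ x, deMajorant b x = H |x| := by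
    intro x
    simp only [H, deMajorant, Real.cosh_abs, Real.abs_sinh]
  simp_rw [h1]
  rw [integral_comp_abs]
  have h2 : ∫ x in Set.Ioi (0 : ℝ), H x = 0 - -(π / b) * Real.exp (-(b * Real.sinh 0)) := by
    refine integral_Ioi_of_hasDerivAt_of_nonneg'
      (g := fun x => -(π / b) * Real.exp (-(b * Real.sinh x))) ?_ ?_ ?_
    · intro x _
      have := (((Real.hasDerivAt_sinh x).const_mul b).fun_neg.exp).const_mul (-(π / b))
      convert! this using 1
      simp only [H]
      field_simp
    · intro x _
      have := Real.cosh_pos x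
      positivity
    · have h3 : Tendsto Real.sinh atTop atTop :=
        tendsto_atTop_mono' _ ((eventually_ge_atTop 0).mono fun x hx => Real.self_le_sinh_iff.2 hx)
          tendsto_id
      have := (Real.tendsto_exp_neg_atTop_nhds_zero.comp (h3.const_mul_atTop hb)).const_mul (-(π / b))
      simpa using this
  rw [h2]
  simp
  ring

end SincDE

/-! ### The constant `exp (π / 12)` on the real line -/

namespace SincDE

open Real in
theorem exp_le_quadratic_of_nonpos {t : ℝ} (ht : t ≤ 0) : exp t ≤ 1 + t + t ^ 2 / 2 := by
  have hd : ∀ x : ℝ, HasDerivAt (fun x => exp x - (1 + x + x ^ 2 / 2)) (exp x - (1 + x)) x := by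
    intro x
    have h1 : HasDerivAt (fun x : ℝ => 1 + x + x ^ 2 / 2) (1 + x) x := by
      have := ((hasDerivAt_id x).const_add 1).add (((hasDerivAt_id x).pow 2).div_const 2)
      convert! this using 1
      simp
    exact (hasDerivAt_exp x).sub h1
  have hm : Monotone fun x : ℝ => exp x - (1 + x + x ^ 2 / 2) := by
    refine monotone_of_deriv_nonneg (fun x => (hd x).differentiableAt) fun x => ?_
    rw [(hd x).deriv]
    linarith [add_one_le_exp x]
  have := hm ht
  simp only [exp_zero] at this
  linarith

open Real in
theorem cubic_le_exp (t : ℝ) : 1 + t + t ^ 2 / 2 + t ^ 3 / 6 ≤ exp t := by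
  rcases le_total 0 t with ht | ht
  · have := sum_le_exp_of_nonneg ht 4
    simp only [Finset.sum_range_succ, Finset.sum_range_zero, Nat.factorial] at this
    norm_num at this
    linarith
  · have hd : ∀ x : ℝ, HasDerivAt (fun x => exp x - (1 + x + x ^ 2 / 2 + x ^ 3 / 6))
        (exp x - (1 + x + x ^ 2 / 2)) x := by
      intro x
      have h1 : HasDerivAt (fun x : ℝ => 1 + x + x ^ 2 / 2 + x ^ 3 / 6) (1 + x + x ^ 2 / 2) x := by
        have := (((hasDerivAt_id x).const_add 1).add
          (((hasDerivAt_id x).pow 2).div_const 2)).add (((hasDerivAt_id x).pow 3).div_const 6)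
        convert! this using 1
        simp
        ring
      exact (hasDerivAt_exp x).sub h1
    have hm : AntitoneOn (fun x : ℝ => exp x - (1 + x + x ^ 2 / 2 + x ^ 3 / 6)) (Set.Iic 0) := by
      refine antitoneOn_of_deriv_nonpos (convex_Iic 0)
        (fun x _ => (hd x).continuousAt.continuousWithinAt)
        (fun x _ => (hd x).differentiableAt.differentiableWithinAt) fun x hx => ?_
      rw [interior_Iic] at hx
      rw [(hd x).deriv]
      linarith [exp_le_quadratic_of_nonpos (le_of_lt hx)]
    have := hm ht (Set.mem_Iic.2 le_rfl) ht
    simp only [exp_zero] at this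
    linarith

open Real in
theorem exp_two_le : exp 2 ≤ 7.3891 := by
  have h1 := exp_one_lt_d9
  have h2 : exp 2 = exp 1 ^ 2 := by rw [← exp_nat_mul]; norm_num
  have h3 : exp 1 ^ 2 ≤ 2.7182818286 ^ 2 := by gcongr
  rw [h2]
  norm_num at h3 ⊢
  linarith

open Real in
theorem exp_one_seventy_nine_le : exp (1.79 : ℝ) ≤ 5.995 := by
  have h1 := cubic_le_exp (0.21 : ℝ)
  have h2 : exp (1.79 : ℝ) * exp (0.21 : ℝ) = exp 2 := by
    rw [← exp_add]; norm_num
  have h3 := exp_two_le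
  have h4 := exp_pos (1.79 : ℝ)
  norm_num at h1
  nlinarith

open Real in
-- The maximum of `(1 - (1 + u) exp (-u)) / u` is about `0.2984`, near `u = 1.79`, while `exp (π /
-- 12) - 1` is about `0.29927`; `0.2992` lies between them.
theorem one_sub_le_one_add_mul_exp_neg {u : ℝ} (hu : 0 < u) :
    1 - 0.2992 * u ≤ (1 + u) * exp (-u) := by
  have hE := exp_pos (-u)
  rcases le_total u 0.6 with h | h
  · have h1 := cubic_le_exp (-u)
    have h2 : 1 - 0.2992 * u ≤ (1 + u) * (1 + -u + (-u) ^ 2 / 2 + (-u) ^ 3 / 6) := by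
      have : 0 ≤ u * (0.2992 - u / 2 + u ^ 2 / 3 - u ^ 3 / 6) := by
        refine mul_nonneg hu.le ?_
        have : u ^ 3 ≤ 0.6 * u ^ 2 := by nlinarith [sq_nonneg u]
        nlinarith [sq_nonneg u, sq_nonneg (u - 0.6)]
      nlinarith [pow_pos hu 4, pow_pos hu 3]
    exact h2.trans (mul_le_mul_of_nonneg_left h1 (by linarith))
  · rcases le_total (1 / 0.2992) u with h' | h'
    · have : 0 ≤ (1 + u) * exp (-u) := by positivity
      rw [div_le_iff₀ (by norm_num)] at h'
      linarith
    · rw [le_div_iff₀ (by norm_num)] at h'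
      -- The margin is small, so the cubic Taylor bound is centred near the critical point.
      obtain ⟨v, rfl⟩ : ∃ v, u = 1.79 + v := ⟨u - 1.79, by ring⟩
      have h1 := cubic_le_exp (-v)
      have h2 : exp (-(1.79 + v)) * exp 1.79 = exp (-v) := by rw [← exp_add]; ring_nf
      have hm : 0 ≤ 1 - 0.2992 * (1.79 + v) := by linarith
      have h3 : (1 - 0.2992 * (1.79 + v)) * exp 1.79 ≤ (1 - 0.2992 * (1.79 + v)) * 5.995 :=
        mul_le_mul_of_nonneg_left exp_one_seventy_nine_le hm
      have hv1 : -1.19 ≤ v := by linarith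
      have hv2 : v ≤ 1.56 := by linarith
      have h4 : (1 - 0.2992 * (1.79 + v)) * 5.995 ≤
          (1 + (1.79 + v)) * (1 + -v + (-v) ^ 2 / 2 + (-v) ^ 3 / 6) := by
        have h5 : 0 ≤ (v + 1.19) * (1.56 - v) := mul_nonneg (by linarith) (by linarith)
        have h6 : 0 ≤ v ^ 2 * (0.39 + 0.035 * v - v ^ 2 / 6) := by
          refine mul_nonneg (sq_nonneg _) ?_
          nlinarith
        nlinarith [sq_nonneg (v + 0.3)]
      have h7 : (1 - 0.2992 * (1.79 + v)) * exp 1.79 ≤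
          ((1 + (1.79 + v)) * exp (-(1.79 + v))) * exp 1.79 := by
        rw [mul_assoc, h2]
        exact h3.trans (h4.trans (mul_le_mul_of_nonneg_left h1 (by linarith)))
      exact le_of_mul_le_mul_right h7 (exp_pos _)

open Real in
theorem one_add_mul_one_sub_exp_neg_le {u : ℝ} (hu : 0 < u) :
    (1 + u) * (1 - exp (-u)) ≤ exp (π / 12) * u := by
  have h1 := one_sub_le_one_add_mul_exp_neg hu
  have h2 : 1.2992 ≤ exp (π / 12) := by
    have h3 := pi_gt_d4
    refine le_trans ?_ (exp_le_exp.2 (by linarith : (0.26179 : ℝ) ≤ π / 12))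
    have := sum_le_exp_of_nonneg (by norm_num : (0 : ℝ) ≤ 0.26179) 5
    simp only [Finset.sum_range_succ, Finset.sum_range_zero, Nat.factorial] at this
    norm_num at this
    linarith
  nlinarith

/-! ### Tail sums of `cosh x * exp (-a sinh x)` -/

theorem hasDerivAt_exp_neg_mul_sinh (a x : ℝ) :
    HasDerivAt (fun x => Real.exp (-(a * Real.sinh x)))
      (-(a * (Real.cosh x * Real.exp (-(a * Real.sinh x))))) x := by
  have := ((Real.hasDerivAt_sinh x).const_mul a).fun_neg.exp
  convert! this using 1
  ring

theorem hasDerivAt_cosh_mul_exp (a x : ℝ) :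
    HasDerivAt (fun x => Real.cosh x * Real.exp (-(a * Real.sinh x)))
      ((Real.sinh x - a * (1 + Real.sinh x ^ 2)) * Real.exp (-(a * Real.sinh x))) x := by
  have := (Real.hasDerivAt_cosh x).fun_mul (hasDerivAt_exp_neg_mul_sinh a x)
  convert! this using 1
  have h := Real.cosh_sq x
  linear_combination (a * Real.exp (-(a * Real.sinh x))) * h

theorem mul_cosh_mul_exp_le_sub {a x y : ℝ} (ha : 0 < a) (hxy : x ≤ y)
    (h : AntitoneOn (fun x => Real.cosh x * Real.exp (-(a * Real.sinh x))) (Set.Icc x y)) :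
    (y - x) * (a * (Real.cosh y * Real.exp (-(a * Real.sinh y)))) ≤
      Real.exp (-(a * Real.sinh x)) - Real.exp (-(a * Real.sinh y)) := by
  rcases hxy.eq_or_lt with rfl | hlt
  · simp
  obtain ⟨c, hc, hc'⟩ := exists_hasDerivAt_eq_slope _ _ hlt
    (fun z _ => (hasDerivAt_exp_neg_mul_sinh a z).continuousAt.continuousWithinAt)
    (fun z _ => hasDerivAt_exp_neg_mul_sinh a z)
  rw [eq_div_iff (by linarith)] at hc'
  have h1 := h ⟨hc.1.le, hc.2.le⟩ ⟨hxy, le_rfl⟩ hc.2.le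
  have h2 := mul_le_mul_of_nonneg_left (mul_le_mul_of_nonneg_left h1 ha.le) (sub_nonneg.2 hxy)
  linarith

/-- Right-endpoint sums of `a cosh x exp (-a sinh x)` over `[X, ∞)` are bounded by the integral of
a decreasing majorant that is constant on `[X, p]`. -/
theorem sum_mul_cosh_mul_exp_le {a X p h : ℝ} (ha : 0 < a) (hh : 0 < h) (hXp : X ≤ p)
    (h1 : ∀ x ∈ Set.Icc X p, Real.cosh x * Real.exp (-(a * Real.sinh x)) ≤
      Real.cosh p * Real.exp (-(a * Real.sinh p)))
    (h2 : AntitoneOn (fun x => Real.cosh x * Real.exp (-(a * Real.sinh x))) (Set.Ici p)) (m : ℕ) :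
    ∑ j ∈ Finset.range m, h * (a * (Real.cosh (X + (j + 1) * h) *
        Real.exp (-(a * Real.sinh (X + (j + 1) * h))))) ≤
      Real.exp (-(a * Real.sinh p)) * (1 + a * Real.cosh p * (p - X)) := by
  set F : ℝ → ℝ := fun x => Real.cosh x * Real.exp (-(a * Real.sinh x)) with hF
  set G : ℝ → ℝ := fun x => Real.exp (-(a * Real.sinh x)) with hG
  -- `Φ x` is the integral over `[x, ∞)` of the majorant equal to `a F p` before `p` and to `a F`
  -- after it, so the sum telescopes against `Φ`.
  set Φ : ℝ → ℝ := fun x => G (max x p) + a * F p * (p - min x p) with hΦ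
  have hFpos : ∀ x, 0 < F x := fun x => mul_pos (Real.cosh_pos x) (Real.exp_pos _)
  have hstep : ∀ x, X ≤ x → h * (a * F (x + h)) ≤ Φ x - Φ (x + h) := by
    intro x hx
    rcases le_total (x + h) p with hy | hy
    · have e : Φ x - Φ (x + h) = h * (a * F p) := by
        simp only [hΦ, max_eq_right hy, min_eq_left hy, max_eq_right (by linarith : x ≤ p),
          min_eq_left (by linarith : x ≤ p)]
        ring
      rw [e]
      have := h1 (x + h) ⟨by linarith, hy⟩
      exact mul_le_mul_of_nonneg_left (mul_le_mul_of_nonneg_left this ha.le) hh.le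
    · have hanti : ∀ z, p ≤ z → AntitoneOn F (Set.Icc z (x + h)) := fun z hz =>
        h2.mono fun w hw => hz.trans hw.1
      rcases le_total p x with hp | hp
      · have e : Φ x - Φ (x + h) = G x - G (x + h) := by
          simp only [hΦ, max_eq_left hy, min_eq_right hy, max_eq_left hp, min_eq_right hp]
          ring
        rw [e]
        have := mul_cosh_mul_exp_le_sub ha (by linarith : x ≤ x + h) (hanti x hp)
        simpa using this
      · have e : Φ x - Φ (x + h) = (p - x) * (a * F p) + (G p - G (x + h)) := by
          simp only [hΦ, max_eq_left hy, min_eq_right hy, max_eq_right hp, min_eq_left hp]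
          ring
        rw [e]
        have h3 := mul_cosh_mul_exp_le_sub ha hy (hanti p le_rfl)
        have h4 : F (x + h) ≤ F p := h2 (Set.mem_Ici.2 le_rfl) (Set.mem_Ici.2 hy) hy
        have h5 := mul_le_mul_of_nonneg_left (mul_le_mul_of_nonneg_left h4 ha.le)
          (sub_nonneg.2 hp)
        have h3' : (x + h - p) * (a * F (x + h)) ≤ G p - G (x + h) := h3
        linarith
  have htel : ∀ m : ℕ, ∑ j ∈ Finset.range m, h * (a * F (X + (j + 1) * h)) ≤
      Φ X - Φ (X + m * h) := by
    intro m
    induction m with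
    | zero => simp
    | succ m ih =>
      rw [Finset.sum_range_succ]
      have := hstep (X + m * h) (by have : 0 ≤ m * h := by positivity
                                    linarith)
      rw [show X + m * h + h = X + (m + 1) * h by ring] at this
      push_cast
      linarith
  refine (htel m).trans ?_
  have hpos : 0 ≤ Φ (X + m * h) := by
    have h3 : 0 ≤ p - min (X + m * h) p := sub_nonneg.2 (min_le_right _ _)
    have := (hFpos p).le
    have h4 : 0 ≤ a * F p * (p - min (X + m * h) p) := by positivity
    exact add_nonneg (Real.exp_pos _).le h4
  have e : Φ X = Real.exp (-(a * Real.sinh p)) * (1 + a * Real.cosh p * (p - X)) := by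
    simp only [hΦ, hF, hG, max_eq_right hXp, min_eq_left hXp]
    ring
  linarith

theorem antitoneOn_cosh_mul_exp {a p : ℝ}
    (h : ∀ s, Real.sinh p ≤ s → s - a * (1 + s ^ 2) ≤ 0) :
    AntitoneOn (fun x => Real.cosh x * Real.exp (-(a * Real.sinh x))) (Set.Ici p) := by
  refine antitoneOn_of_deriv_nonpos (convex_Ici p)
    (fun x _ => (hasDerivAt_cosh_mul_exp a x).continuousAt.continuousWithinAt)
    (fun x _ => (hasDerivAt_cosh_mul_exp a x).differentiableAt.differentiableWithinAt)
    fun x hx => ?_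
  rw [interior_Ici] at hx
  rw [(hasDerivAt_cosh_mul_exp a x).deriv]
  exact mul_nonpos_of_nonpos_of_nonneg (h _ (Real.sinh_le_sinh.2 (le_of_lt hx))) (Real.exp_pos _).le

theorem monotoneOn_cosh_mul_exp {a X p : ℝ}
    (h : ∀ s, Real.sinh X ≤ s → s ≤ Real.sinh p → 0 ≤ s - a * (1 + s ^ 2)) :
    MonotoneOn (fun x => Real.cosh x * Real.exp (-(a * Real.sinh x))) (Set.Icc X p) := by
  refine monotoneOn_of_deriv_nonneg (convex_Icc X p)
    (fun x _ => (hasDerivAt_cosh_mul_exp a x).continuousAt.continuousWithinAt)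
    (fun x _ => (hasDerivAt_cosh_mul_exp a x).differentiableAt.differentiableWithinAt)
    fun x hx => ?_
  rw [interior_Icc] at hx
  rw [(hasDerivAt_cosh_mul_exp a x).deriv]
  exact mul_nonneg (h _ (Real.sinh_le_sinh.2 hx.1.le) (Real.sinh_le_sinh.2 hx.2.le))
    (Real.exp_pos _).le

theorem xThreshold_nonneg {γ : ℝ} (hγ : 0 < γ) : 0 ≤ xThreshold γ := by
  have := Real.pi_pos
  unfold xThreshold
  split_ifs
  · exact Real.arsinh_nonneg_iff.2 (by positivity)
  · exact Real.arsinh_nonneg_iff.2 zero_le_one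

/-- The integral of the decreasing majorant in `sum_mul_cosh_mul_exp_le` when `X` lies below the
maximum point `p` of `cosh x * exp (-a sinh x)`; here `sinh p = w / ρ`,
`2 a = w ρ` and `ρ ^ 2 + w ^ 2 = 2`. -/
theorem exp_neg_mul_one_add_le {a w ρ X p L V : ℝ} (hw1 : 1 ≤ w) (hρ0 : 0 < ρ)
    (hwρ : w ^ 2 + ρ ^ 2 = 2) (ha : 2 * a = w * ρ) (hsX : 1 / ρ ≤ Real.sinh X)
    (hsp : Real.sinh p = w / ρ) (hXp : X ≤ p) (hL1 : 1 ≤ L) (hXL : X ≤ L)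
    (hV : V ≤ a * Real.exp X / 2) :
    Real.exp (-(a * Real.sinh p)) * (1 + a * Real.cosh p * (p - X)) ≤
      Real.exp (a / 2 - V / L) := by
  have hw0 : 0 < w := by linarith
  have ha0 : 0 < a := by nlinarith [mul_pos hw0 hρ0]
  obtain ⟨σ, hσ0, hσ⟩ : ∃ σ : ℝ, 0 < σ ∧ σ ^ 2 = 2 :=
    ⟨√2, by positivity, Real.sq_sqrt (by norm_num)⟩
  have hσl : 1.4142 < σ := by nlinarith
  have hσu : σ < 1.4143 := by nlinarith
  have hwσ : w ≤ σ := by nlinarith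
  have hcp : Real.cosh p = σ / ρ := by
    have h1 : Real.cosh p ^ 2 = (σ / ρ) ^ 2 := by
      rw [Real.cosh_sq, hsp, div_pow, div_pow, hσ]
      field_simp
      linarith
    exact (sq_eq_sq₀ (Real.cosh_pos p).le (by positivity)).1 h1
  have hep : Real.exp p = (w + σ) / ρ := by
    rw [← Real.cosh_add_sinh, hcp, hsp]; ring
  have hcX : w / ρ ≤ σ * Real.cosh X := by
    refine (sq_le_sq₀ (by positivity) (mul_pos hσ0 (Real.cosh_pos X)).le).1 ?_
    rw [mul_pow, hσ, Real.cosh_sq]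
    have h2 : (1 / ρ) ^ 2 ≤ Real.sinh X ^ 2 := by gcongr
    have h3 : (w / ρ) ^ 2 ≤ 2 * (1 / ρ) ^ 2 := by
      rw [div_pow, div_pow, one_pow, mul_one_div]
      gcongr
      linarith [sq_nonneg ρ]
    linarith
  have heX : (w + σ) / ρ ≤ σ * Real.exp X := by
    rw [← Real.cosh_add_sinh, mul_add, add_div]
    have h1 : σ / ρ ≤ σ * Real.sinh X := by
      calc σ / ρ = σ * (1 / ρ) := by ring
        _ ≤ _ := by gcongr
    linarith
  obtain ⟨t, ht⟩ : ∃ t, t = p - X := ⟨_, rfl⟩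
  have ht0 : 0 ≤ t := by linarith
  have hpt : Real.exp p = Real.exp X * Real.exp t := by
    rw [← Real.exp_add, ht]; ring_nf
  -- Since `sinh X ≥ 1 / ρ` and `w ≤ √2`, the gap `t = p - X` is at most `log √2 < 0.35`.
  have het : Real.exp t ≤ σ := by
    have h1 : Real.exp X * Real.exp t ≤ Real.exp X * σ := by
      rw [← hpt, hep]; linarith
    exact le_of_mul_le_mul_left h1 (Real.exp_pos X)
  have ht1 : t ≤ 0.35 := by
    by_contra hcon
    push Not at hcon
    have h1 := Real.exp_lt_exp.2 hcon
    have h2 := cubic_le_exp (0.35 : ℝ)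
    norm_num at h2
    linarith
  have hXt : Real.exp X = (w + σ) / ρ * Real.exp (-t) := by
    rw [← hep, ← Real.exp_add, ht]; ring_nf
  have hV2 : V ≤ w * (w + σ) * Real.exp (-t) / 4 := by
    refine hV.trans_eq ?_
    rw [hXt, show a = w * ρ / 2 by linarith]
    field_simp
    ring
  have hEt : Real.exp (-t) ≤ 1 - t + t ^ 2 / 2 := by
    have := exp_le_quadratic_of_nonpos (neg_nonpos.2 ht0)
    linarith [neg_sq t]
  have hEt1 : Real.exp (-t) ≤ 1 := by simpa using ht0
  have e1 : a * Real.sinh p = w ^ 2 / 2 := by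
    rw [hsp, show a = w * ρ / 2 by linarith]; field_simp
  have e2 : a * Real.cosh p = w * σ / 2 := by
    rw [hcp, show a = w * ρ / 2 by linarith]; field_simp
  rw [e1, e2, ← ht]
  -- With `1 + y ≤ exp y` only exponents remain: `-w²/2 + wσt/2 ≤ wρ/4 - V/L`.
  have h1 : 1 + w * σ / 2 * t ≤ Real.exp (w * σ / 2 * t) := by
    linarith [Real.add_one_le_exp (w * σ / 2 * t)]
  refine (mul_le_mul_of_nonneg_left h1 (Real.exp_pos _).le).trans ?_
  rw [← Real.exp_add, Real.exp_le_exp, show a = w * ρ / 2 by linarith]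
  have hL0 : 0 < L := by linarith
  -- If `w` is away from `√2`, the term `wρ/4` suffices with `L ≥ 1`. If `w` is close to `√2`, then
  -- `ρ` is too small to help, but it forces `X ≥ 2`, and `L ≥ 2` halves `V`.
  rcases le_total 0.02 (σ - w) with hε | hε
  · have h2 : V / L ≤ w * (w + σ) * (1 - t + t ^ 2 / 2) / 4 := by
      rw [div_le_iff₀ hL0]
      have h3 : w * (w + σ) * Real.exp (-t) / 4 ≤ w * (w + σ) * (1 - t + t ^ 2 / 2) / 4 := by
        gcongr
      have h4 : 0 ≤ w * (w + σ) * (1 - t + t ^ 2 / 2) / 4 := le_trans (by positivity) h3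
      exact (hV2.trans h3).trans (le_mul_of_one_le_right h4 hL1)
    -- The constants are those needed for `(σ - w) (1 + t) + (w + σ) t² / 2 ≤ ρ` with `t ≤ 0.35`.
    have h5 : 1.35 * (σ - w) + 0.1733 ≤ ρ := by
      have hε1 : σ - w ≤ 0.4143 := by linarith
      refine (sq_le_sq₀ (by linarith) hρ0.le).1 ?_
      have e : ρ ^ 2 = (σ - w) * (2 * σ) - (σ - w) ^ 2 := by linear_combination hwρ - hσ
      have h6 : (σ - w) * 2.8284 ≤ (σ - w) * (2 * σ) :=
        mul_le_mul_of_nonneg_left (by linarith) (by linarith)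
      have h7 := mul_nonneg (sub_nonneg.2 hε) (sub_nonneg.2 hε1)
      rw [e]
      generalize σ - w = ε at *
      linarith
    have h6 : (σ - w) * t + (w + σ) * (t ^ 2 / 2) ≤ ρ - (σ - w) := by
      have h7 : (σ - w) * t ≤ (σ - w) * 0.35 := mul_le_mul_of_nonneg_left ht1 (by linarith)
      have h8 : t ^ 2 / 2 ≤ 0.06125 := by
        have : t ^ 2 ≤ 0.35 ^ 2 := pow_le_pow_left₀ ht0 ht1 2
        linarith
      have h9 : (w + σ) * (t ^ 2 / 2) ≤ 2.8286 * 0.06125 := by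
        gcongr
        linarith
      linarith
    have h10 := mul_le_mul_of_nonneg_left h6 hw0.le
    linarith
  · have h3 : 2 ≤ X := by
      refine Real.sinh_le_sinh.1 (le_trans ?_ hsX)
      have h4 : ρ ≤ 0.2385 := by
        refine (sq_le_sq₀ hρ0.le (by norm_num)).1 ?_
        have h5 : 1.394 ^ 2 ≤ w ^ 2 := pow_le_pow_left₀ (by norm_num) (by linarith) 2
        linarith
      have h5 : (4.1 : ℝ) ≤ 1 / ρ := by
        rw [le_div_iff₀ hρ0]; linarith
      refine le_trans ?_ h5
      rw [Real.sinh_eq]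
      linarith [Real.exp_pos (-2), exp_two_le]
    have h4 : V / L ≤ w * (w + σ) / 8 := by
      rw [div_le_iff₀ hL0]
      have h5 : w * (w + σ) * Real.exp (-t) / 4 ≤ w * (w + σ) * 1 / 4 := by gcongr
      have h6 : 0 < w * (w + σ) := by positivity
      have h7 := mul_le_mul_of_nonneg_left (h3.trans hXL) h6.le
      linarith
    have h7 : w + σ + 4 * σ * t ≤ 4 * w := by
      have : σ * t ≤ 1.4143 * 0.35 := mul_le_mul hσu.le ht1 ht0 (by norm_num)
      linarith
    have h8 := mul_le_mul_of_nonneg_left h7 hw0.le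
    have h9 : 0 < w * ρ := by positivity
    linarith

/-- Put `a = πγ`. If the summand decreases beyond `X`, the sum is at most `exp (-a sinh X) ≤ exp
(a/2) exp (-πT/2)`, even without the division by `L`. Otherwise `X` lies before the maximum, and
`exp_neg_mul_one_add_le` uses the slack in `L`. -/
theorem tail_sum_le {γ X h L T : ℝ} (hγ : 0 < γ) (hX : xThreshold γ ≤ X) (hh : 0 < h)
    (hL1 : 1 ≤ L) (hXL : X ≤ L) (hT0 : 0 ≤ T) (hT : T ≤ γ * Real.exp X) (m : ℕ) :
    ∑ j ∈ Finset.range m, h * (Real.pi * Real.cosh (X + (j + 1) * h) *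
        Real.exp (-(Real.pi * γ * Real.sinh (X + (j + 1) * h)))) ≤
      1 / γ * (Real.exp (Real.pi * γ / 2) * Real.exp (-(Real.pi * T / (2 * L)))) := by
  have hpi := Real.pi_pos
  set a := Real.pi * γ with ha
  have ha0 : 0 < a := by positivity
  have hX0 : 0 ≤ X := (xThreshold_nonneg hγ).trans hX
  suffices hs : ∑ j ∈ Finset.range m, h * (a * (Real.cosh (X + (j + 1) * h) *
        Real.exp (-(a * Real.sinh (X + (j + 1) * h))))) ≤
      Real.exp (a / 2) * Real.exp (-(Real.pi * T / (2 * L))) by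
    rw [one_div, inv_mul_eq_div, le_div_iff₀ hγ, Finset.sum_mul]
    refine le_of_eq_of_le (Finset.sum_congr rfl fun j _ => ?_) hs
    rw [ha]; ring
  have hV : Real.pi * T / 2 ≤ a * Real.exp X / 2 := by
    rw [ha]; nlinarith
  have hL0 : 0 < L := by linarith
  have hmono : (∀ s, Real.sinh X ≤ s → s - a * (1 + s ^ 2) ≤ 0) →
      ∑ j ∈ Finset.range m, h * (a * (Real.cosh (X + (j + 1) * h) *
        Real.exp (-(a * Real.sinh (X + (j + 1) * h))))) ≤
      Real.exp (a / 2) * Real.exp (-(Real.pi * T / (2 * L))) := by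
    intro hs
    refine (sum_mul_cosh_mul_exp_le ha0 hh le_rfl (fun x hx => ?_)
      (antitoneOn_cosh_mul_exp hs) m).trans ?_
    · rw [le_antisymm hx.2 hx.1]
    · rw [sub_self, mul_zero, add_zero, mul_one, ← Real.exp_add, Real.exp_le_exp, Real.sinh_eq]
      have h1 : Real.exp (-X) ≤ 1 := by simpa using hX0
      have h2 : Real.pi * T / (2 * L) ≤ Real.pi * T / 2 := by
        gcongr
        linarith
      nlinarith
  rcases le_or_gt (1 / 2) a with ha1 | ha1
  · refine hmono fun s _ => ?_
    nlinarith [sq_nonneg (s - 1), sq_nonneg s]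
  have hγ1 : γ < 1 / (2 * Real.pi) := by
    rw [lt_div_iff₀ (by positivity)]; linarith
  rw [xThreshold, if_pos hγ1, show 2 * Real.pi * γ = 2 * a by rw [ha]; ring] at hX
  have hr : 0 ≤ 1 - (2 * a) ^ 2 := by nlinarith
  have hr1 := Real.sq_sqrt hr
  have hr0 := Real.sqrt_nonneg (1 - (2 * a) ^ 2)
  set r := √(1 - (2 * a) ^ 2)
  have hr2 : r < 1 := by nlinarith
  have hw2 := Real.sq_sqrt (by linarith : 0 ≤ 1 + r)
  have hw0 := Real.sqrt_nonneg (1 + r)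
  set w := √(1 + r)
  have hρ2 := Real.sq_sqrt (by linarith : 0 ≤ 1 - r)
  have hρ0 := Real.sqrt_pos.2 (by linarith : 0 < 1 - r)
  set ρ := √(1 - r)
  have hw1 : 1 ≤ w := by nlinarith
  have hwρ : w ^ 2 + ρ ^ 2 = 2 := by linarith
  have haw : 2 * a = w * ρ := by
    refine (sq_eq_sq₀ (by positivity) (by positivity)).1 ?_
    rw [mul_pow w, hw2, hρ2]; nlinarith
  -- In these variables the threshold is `w / (2a) = 1 / ρ`.
  have hsX : 1 / ρ ≤ Real.sinh X := by
    rw [← Real.sinh_le_sinh, Real.sinh_arsinh, haw] at hX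
    refine le_of_eq_of_le ?_ hX
    field_simp
  -- The derivative of the summand has the sign of this quadratic in `s = sinh x`, whose roots are
  -- `ρ / w` and `w / ρ`; the maximum is at the larger one.
  have hroot : ∀ s, s - a * (1 + s ^ 2) = ρ ^ 2 / 2 * (s - w / ρ) * (1 - s * (w / ρ)) := by
    intro s
    rw [show a = w * ρ / 2 by linarith]
    field_simp
    linear_combination (-s * hwρ)
  have hwρ1 : 1 ≤ w / ρ := by
    rw [le_div_iff₀ hρ0]; nlinarith
  have hle : ∀ s, w / ρ ≤ s → s - a * (1 + s ^ 2) ≤ 0 := by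
    intro s hs
    rw [hroot]
    refine mul_nonpos_of_nonneg_of_nonpos (mul_nonneg (by positivity) (by linarith)) ?_
    nlinarith
  rcases le_or_gt (w / ρ) (Real.sinh X) with hcase | hcase
  · exact hmono fun s hs => hle s (hcase.trans hs)
  have hsp : Real.sinh (Real.arsinh (w / ρ)) = w / ρ := Real.sinh_arsinh _
  set p := Real.arsinh (w / ρ)
  have hXp : X ≤ p := Real.sinh_le_sinh.1 (hsp ▸ hcase.le)
  have hmon : MonotoneOn (fun x => Real.cosh x * Real.exp (-(a * Real.sinh x))) (Set.Icc X p) := by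
    refine monotoneOn_cosh_mul_exp fun s hs1 hs2 => ?_
    rw [hsp] at hs2
    rw [hroot]
    have h1 : 1 ≤ s := by
      have : 1 ≤ 1 / ρ := by rw [le_div_iff₀ hρ0]; nlinarith
      linarith
    have h2 : 1 - s * (w / ρ) ≤ 0 := by nlinarith
    exact mul_nonneg_of_nonpos_of_nonpos
      (mul_nonpos_of_nonneg_of_nonpos (by positivity) (by linarith)) h2
  refine (sum_mul_cosh_mul_exp_le ha0 hh hXp
    (fun x hx => hmon hx ⟨hXp, le_rfl⟩ hx.2)
    (antitoneOn_cosh_mul_exp fun s hs => hle s (hsp ▸ hs)) m).trans ?_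
  refine (exp_neg_mul_one_add_le hw1 hρ0 hwρ haw hsX hsp hXp hL1 hXL hV).trans_eq ?_
  rw [← Real.exp_add]
  congr 1
  field_simp
  ring

end SincDE

/-! ### Truncation of the bilateral sum -/

namespace SincDE

open MeasureTheory Filter Topology

/-- One bound for each tail: the factor that decays there is kept and the other is bounded by `1`.
-/
theorem norm_integrand_ofReal_le_exp {d K α β : ℝ} (hd0 : 0 < d) (hd : d < Real.pi / 2)
    (hK : 0 < K) (hα : 0 < α) (hα1 : α ≤ 1) (hβ : 0 < β) {f : ℂ → ℂ}
    (hbound : ∀ z ∈ psi '' strip d, ‖f z‖ ≤ K * ‖E3 α β z‖) (x : ℝ) :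
    ‖f (psi x) * deriv psi x‖ ≤ K * Real.exp (Real.pi * (1 - α) / 12) *
        (Real.pi * Real.cosh x * Real.exp (-(Real.pi * β * Real.sinh x))) ∧
    ‖f (psi x) * deriv psi x‖ ≤ K * Real.exp (Real.pi * (1 - α) / 12) *
        (Real.pi * Real.cosh x * Real.exp (Real.pi * α * Real.sinh x)) := by
  have h := norm_integrand_ofReal_le hd0 hd hK hα hα1 hβ hbound
    (fun u hu => one_add_mul_one_sub_exp_neg_le hu) x
  have e : Real.exp (Real.pi / 12) ^ (1 - α) = Real.exp (Real.pi * (1 - α) / 12) := by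
    rw [← Real.exp_mul]; ring_nf
  rw [e] at h
  have hpi := Real.pi_pos
  have hcosh := Real.cosh_pos x
  have key : ∀ B, (1 + Real.exp (-(Real.pi * Real.sinh x)))⁻¹ ^ α *
      (1 + Real.exp (Real.pi * Real.sinh x))⁻¹ ^ β ≤ B →
      ‖f (psi x) * deriv psi x‖ ≤ K * Real.exp (Real.pi * (1 - α) / 12) *
        (Real.pi * Real.cosh x * B) := by
    intro B hB
    refine h.trans ?_
    calc _ ≤ K * Real.exp (Real.pi * (1 - α) / 12) * B * (Real.pi * Real.cosh x) := by gcongr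
      _ = _ := by ring
  constructor
  · refine key _ ((inv_rpow_mul_inv_rpow_le_right hα hβ _).trans_eq ?_)
    ring_nf
  · refine key _ ((inv_rpow_mul_inv_rpow_le_left hα hβ _).trans_eq ?_)
    ring_nf

/-- The tails of a bilateral sum. -/
theorem norm_tsum_sub_sum_Icc_le {u : ℤ → ℂ} (hu : Summable u) {M N : ℤ} (hMN : -M ≤ N) {A B : ℝ}
    (hA : ∀ m : ℕ, ∑ j ∈ Finset.range m, ‖u (N + (j + 1))‖ ≤ A)
    (hB : ∀ m : ℕ, ∑ j ∈ Finset.range m, ‖u (-(M + (j + 1)))‖ ≤ B) :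
    ‖∑' k, u k - ∑ k ∈ Finset.Icc (-M) N, u k‖ ≤ A + B := by
  have hstep : ∀ m : ℕ, ‖∑ k ∈ Finset.Icc (-(M + m)) (N + m), u k -
      ∑ k ∈ Finset.Icc (-M) N, u k‖ ≤ (∑ j ∈ Finset.range m, ‖u (N + (j + 1))‖) +
        ∑ j ∈ Finset.range m, ‖u (-(M + (j + 1)))‖ := by
    intro m
    induction m with
    | zero => simp
    | succ m ih =>
      have e : Finset.Icc (-(M + ((m + 1 : ℕ) : ℤ))) (N + ((m + 1 : ℕ) : ℤ)) =
          insert (N + ((m : ℤ) + 1)) (insert (-(M + ((m : ℤ) + 1)))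
            (Finset.Icc (-(M + (m : ℤ))) (N + (m : ℤ)))) := by
        ext k
        simp only [Finset.mem_Icc, Finset.mem_insert]
        push_cast
        omega
      rw [e, Finset.sum_insert (by simp only [Finset.mem_Icc, Finset.mem_insert]; omega),
        Finset.sum_insert (by simp only [Finset.mem_Icc]; omega), Finset.sum_range_succ,
        Finset.sum_range_succ]
      calc _ = ‖u (N + (m + 1)) + (u (-(M + (m + 1))) +
            (∑ k ∈ Finset.Icc (-(M + (m : ℤ))) (N + m), u k - ∑ k ∈ Finset.Icc (-M) N, u k))‖ := by
            congr 1; ring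
        _ ≤ ‖u (N + (m + 1))‖ + (‖u (-(M + (m + 1)))‖ +
            ‖∑ k ∈ Finset.Icc (-(M + (m : ℤ))) (N + m), u k - ∑ k ∈ Finset.Icc (-M) N, u k‖) :=
            (norm_add_le _ _).trans (by gcongr; exact norm_add_le _ _)
        _ ≤ _ := by linarith
  have hlim : Tendsto (fun m : ℕ => Finset.Icc (-(M + (m : ℤ))) (N + m)) atTop atTop := by
    refine tendsto_atTop_finset_of_monotone (fun a b hab => ?_) fun k => ?_
    · exact Finset.Icc_subset_Icc (by omega) (by omega)
    · refine ⟨(|k| + |M| + |N|).toNat, ?_⟩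
      rw [Finset.mem_Icc]
      have := abs_nonneg k
      have := abs_nonneg M
      have := abs_nonneg N
      have := neg_abs_le k
      have := le_abs_self k
      have := neg_abs_le M
      have := neg_abs_le N
      omega
  have h1 := ((hu.hasSum.comp hlim).sub_const (∑ k ∈ Finset.Icc (-M) N, u k)).norm
  exact le_of_tendsto h1 (Eventually.of_forall fun m => (hstep m).trans (add_le_add (hA m) (hB m)))

/-! ### The change of variables -/

theorem ofReal_mem_strip {d : ℝ} (hd : 0 < d) (t : ℝ) : (t : ℂ) ∈ strip d := by
  simpa [strip] using hd

theorem deriv_psi_ofReal (t : ℝ) :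
    deriv psi t = ((Real.pi * Real.cosh t *
      (1 - Real.exp (-Real.log (1 + Real.exp (Real.pi * Real.sinh t)))) : ℝ) : ℂ) := by
  rw [deriv_psi (ofReal_mem_strip Real.pi_div_two_pos t), psi_ofReal]
  push_cast
  rfl

theorem deriv_psi_ofReal_nonneg (t : ℝ) : 0 ≤ (deriv psi t).re := by
  rw [deriv_psi_ofReal, Complex.ofReal_re]
  have h1 : 0 < Real.log (1 + Real.exp (Real.pi * Real.sinh t)) :=
    Real.log_pos (by linarith [Real.exp_pos (Real.pi * Real.sinh t)])
  have h2 := Real.exp_le_one_iff.2 (neg_nonpos.2 h1.le)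
  have := Real.cosh_pos t
  have := Real.pi_pos
  exact mul_nonneg (by positivity) (by linarith)

theorem image_psi_re : (fun t : ℝ => (psi t).re) '' Set.univ = Set.Ioi 0 := by
  have hpi := Real.pi_pos
  ext y
  simp only [Set.image_univ, Set.mem_range, Set.mem_Ioi, psi_ofReal, Complex.ofReal_re]
  constructor
  · rintro ⟨t, rfl⟩
    exact Real.log_pos (by linarith [Real.exp_pos (Real.pi * Real.sinh t)])
  · intro hy
    refine ⟨Real.arsinh (Real.log (Real.exp y - 1) / Real.pi), ?_⟩
    have : 0 < Real.exp y - 1 := sub_pos.2 (Real.one_lt_exp_iff.2 hy)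
    rw [Real.sinh_arsinh, mul_div_cancel₀ _ hpi.ne', Real.exp_log this, add_sub_cancel,
      Real.log_exp]

theorem injective_psi_re : Function.Injective fun t : ℝ => (psi t).re := by
  intro s t h
  simp only [psi_ofReal, Complex.ofReal_re] at h
  have h1 := Real.log_injOn_pos (Set.mem_Ioi.2 (by positivity)) (Set.mem_Ioi.2 (by positivity)) h
  have h2 := Real.exp_injective (add_left_cancel h1)
  exact Real.sinh_injective (mul_left_cancel₀ Real.pi_ne_zero h2)

theorem ofReal_psi_re (t : ℝ) : (((psi t).re : ℝ) : ℂ) = psi t := by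
  rw [psi_ofReal, Complex.ofReal_re]

/-- On the line `ψ` is a real injection with image `(0, ∞)` and nonnegative derivative, so the
change of variables transfers integrability along with the value. -/
theorem integral_comp_psi (f : ℂ → ℂ) :
    (IntegrableOn (fun t : ℝ => f t) (Set.Ioi 0) ↔
      Integrable fun t : ℝ => f (psi t) * deriv psi t) ∧
    ∫ t in Set.Ioi (0 : ℝ), f t = ∫ t : ℝ, f (psi t) * deriv psi t := by
  have hd : ∀ t ∈ (Set.univ : Set ℝ),
      HasDerivWithinAt (fun t : ℝ => (psi t).re) ((deriv psi t).re) Set.univ t := by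
    intro t _
    have ht := ofReal_mem_strip Real.pi_div_two_pos t
    exact (((differentiableOn_psi _ ht).differentiableAt
      ((isOpen_strip _).mem_nhds ht)).hasDerivAt.real_of_complex).hasDerivWithinAt
  have e : ∀ t : ℝ, |(deriv psi t).re| • f ((psi t).re : ℝ) = f (psi t) * deriv psi t := by
    intro t
    rw [abs_of_nonneg (deriv_psi_ofReal_nonneg t), ofReal_psi_re, Complex.real_smul, mul_comm]
    congr 1
    rw [deriv_psi_ofReal, Complex.ofReal_re]
  have h1 := integrableOn_image_iff_integrableOn_abs_deriv_smul MeasurableSet.univ hd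
    injective_psi_re.injOn (fun t : ℝ => f t)
  have h2 := integral_image_eq_integral_abs_deriv_smul MeasurableSet.univ hd
    injective_psi_re.injOn (fun t : ℝ => f t)
  simp only [e, image_psi_re] at h1 h2
  rw [integrableOn_univ] at h1
  rw [setIntegral_univ] at h2
  exact ⟨h1, h2⟩

/-! ### Comparison of the rates -/

/-- The exponents differ by `2πdn log (c/4)` over the product of the two logarithms, which is at
least a constant times `u / log² u` with `u = cdn / μ`, hence unbounded. -/
theorem isLittleO_exp_rate {d μ c : ℝ} (hd : 0 < d) (hμ : 0 < μ) (hc : 4 < c) :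
    (fun n : ℕ => Real.exp (-(2 * Real.pi * d * n / Real.log (4 * d * n / μ))))
        =o[atTop]
      fun n : ℕ => Real.exp (-(2 * Real.pi * d * n / Real.log (c * d * n / μ))) := by
  have hpi := Real.pi_pos
  rw [Real.isLittleO_exp_comp_exp_comp]
  have hu : Tendsto (fun n : ℕ => c * d * n / μ) atTop atTop := by
    have : Tendsto (fun n : ℕ => c * d / μ * n) atTop atTop :=
      tendsto_natCast_atTop_atTop.const_mul_atTop (by positivity)
    refine this.congr fun n => by ring
  have hq : Tendsto (fun u : ℝ => u / Real.log u ^ 2) atTop atTop := by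
    have h1 : Tendsto (fun u : ℝ => Real.log u ^ 2 / u) atTop (𝓝 0) :=
      (Real.isLittleO_pow_log_id_atTop (n := 2)).tendsto_div_nhds_zero
    have h2 : Tendsto (fun u : ℝ => Real.log u ^ 2 / u) atTop (𝓝[>] 0) := by
      refine tendsto_nhdsWithin_iff.2 ⟨h1, ?_⟩
      filter_upwards [eventually_gt_atTop 1] with u hu
      have := Real.log_pos hu
      have : 0 < u := by linarith
      exact Set.mem_Ioi.2 (by positivity)
    refine h2.inv_tendsto_nhdsGT_zero.congr fun u => ?_
    simp
  have hlogc : 0 < Real.log (c / 4) := Real.log_pos (by linarith)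
  have hmain := (hq.comp hu).const_mul_atTop
    (show 0 < 2 * Real.pi * μ / c * Real.log (c / 4) by positivity)
  refine tendsto_atTop_mono' _ ?_ hmain
  filter_upwards [hu.eventually_gt_atTop (c / 4)] with n hn
  have hn0 : 0 < (n : ℝ) := by
    rw [lt_div_iff₀ hμ] at hn
    have : 0 < c * d * n := lt_trans (by positivity) hn
    exact (pos_iff_pos_of_mul_pos this).1 (by positivity)
  have h4 : 1 < 4 * d * n / μ := by
    have : 4 * d * n / μ = (c * d * n / μ) / (c / 4) := by field_simp
    rw [this, one_lt_div (by positivity)]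
    exact hn
  have hl4 : 0 < Real.log (4 * d * n / μ) := Real.log_pos h4
  have hlc : Real.log (c * d * n / μ) = Real.log (4 * d * n / μ) + Real.log (c / 4) := by
    rw [← Real.log_mul (by positivity) (by positivity)]
    congr 1
    field_simp
  have hlc0 : 0 < Real.log (c * d * n / μ) := by rw [hlc]; positivity
  have hle : Real.log (4 * d * n / μ) ≤ Real.log (c * d * n / μ) := by rw [hlc]; linarith
  have e : -(2 * Real.pi * d * n / Real.log (c * d * n / μ)) -
      -(2 * Real.pi * d * n / Real.log (4 * d * n / μ)) =
      2 * Real.pi * d * n * Real.log (c / 4) /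
        (Real.log (4 * d * n / μ) * Real.log (c * d * n / μ)) := by
    have key : ∀ A B r : ℝ, A ≠ 0 → B ≠ 0 → -(r / B) - -(r / A) = r * (B - A) / (A * B) := by
      intro A B r hA hB
      field_simp
      ring
    rw [key _ _ _ hl4.ne' hlc0.ne', hlc]
    ring
  rw [e, Function.comp_apply]
  calc 2 * Real.pi * μ / c * Real.log (c / 4) *
        (c * d * n / μ / Real.log (c * d * n / μ) ^ 2)
      = 2 * Real.pi * d * n * Real.log (c / 4) /
        (Real.log (c * d * n / μ) * Real.log (c * d * n / μ)) := by
        field_simp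
    _ ≤ _ := by gcongr

/-! ### Step size and truncation numbers -/

theorem exp_one_mul_log_le {x : ℝ} (hx : 0 < x) : Real.exp 1 * Real.log x ≤ x := by
  have h1 : Real.log (x / Real.exp 1) ≤ x / Real.exp 1 - 1 :=
    Real.log_le_sub_one_of_pos (by positivity)
  rw [Real.log_div hx.ne' (Real.exp_pos 1).ne', Real.log_exp, sub_le_sub_iff_right,
    le_div_iff₀ (Real.exp_pos 1)] at h1
  linarith

theorem one_le_log_of_le {d μ ν x n : ℝ} (hd : 0 < d) (hμ : 0 < μ) (hμν : μ ≤ ν)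
    (hx : x = 4 * d * n / μ) (hn : ν * Real.exp 1 / (4 * d) ≤ n) : 1 ≤ Real.log x := by
  rw [div_le_iff₀ (by positivity)] at hn
  have h1 : Real.exp 1 ≤ x := by
    rw [hx, le_div_iff₀ hμ]
    nlinarith [Real.exp_pos 1]
  rw [← Real.log_exp 1]
  exact Real.log_le_log (Real.exp_pos 1) h1

/-- The truncation numbers: with `L = log (T / min γ δ)`, `h = L / n` and the number `N` belonging
to the exponent `γ`, the product `N h` is at most `L` and `γ exp (N h)` is at least `T`. -/
theorem truncation_bounds {γ δ h L T : ℝ} {n : ℕ} {N : ℤ} (hγ : 0 < γ) (hδ : 0 < δ) (hh : 0 < h)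
    (hT : 0 < T) (hnh : n * h = L) (hL : L = Real.log (T / min γ δ))
    (hN : N = if min γ δ = γ then (n : ℤ) else n - ⌊Real.log (γ / δ) / h⌋) :
    N * h ≤ L ∧ T ≤ γ * Real.exp (N * h) := by
  have hμ : 0 < min γ δ := lt_min hγ hδ
  have hexp : Real.exp L = T / min γ δ := by rw [hL, Real.exp_log (by positivity)]
  split_ifs at hN with hc
  · have e : (N : ℝ) * h = L := by rw [hN, ← hnh]; push_cast; ring
    rw [e, hexp, hc]
    exact ⟨le_rfl, by rw [mul_div_cancel₀ _ hγ.ne']⟩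
  · have hlt : δ < γ := by
      by_contra hcon
      exact hc (min_eq_left (not_lt.1 hcon))
    rw [min_eq_right hlt.le] at hexp
    have hlog : 0 ≤ Real.log (γ / δ) := Real.log_nonneg (by rw [le_div_iff₀ hδ]; linarith)
    have h1 := Int.floor_le (Real.log (γ / δ) / h)
    have h2 : (0 : ℤ) ≤ ⌊Real.log (γ / δ) / h⌋ := Int.floor_nonneg.2 (by positivity)
    have h3 : (0 : ℝ) ≤ ⌊Real.log (γ / δ) / h⌋ := by exact_mod_cast h2
    have e : (N : ℝ) * h = L - ⌊Real.log (γ / δ) / h⌋ * h := by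
      rw [hN, ← hnh]; push_cast; ring
    rw [le_div_iff₀ hh] at h1
    refine ⟨by rw [e]; nlinarith, ?_⟩
    -- Rounding the subtracted amount down only moves the cut-off outwards.
    have h4 : L - Real.log (γ / δ) ≤ N * h := by rw [e]; linarith
    calc T = γ * Real.exp (L - Real.log (γ / δ)) := by
          rw [Real.exp_sub, hexp, Real.exp_log (by positivity)]
          field_simp
      _ ≤ _ := by gcongr

end SincDE

/-! ### Assembly of the error bound -/

namespace SincDE

open MeasureTheory

/-- The error of the truncated trapezoidal rule for the transformed integrand. -/
theorem norm_integral_sub_sum_le {d K α β : ℝ} (hd0 : 0 < d) (hd : d < Real.pi / 2)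
    (hK : 0 < K) (hα : 0 < α) (hα1 : α ≤ 1) (hβ : 0 < β) {f : ℂ → ℂ}
    (hf : AnalyticOnNhd ℂ f (psi '' strip d))
    (hbound : ∀ z ∈ psi '' strip d, ‖f z‖ ≤ K * ‖E3 α β z‖)
    {h A B : ℝ} (hh : 0 < h) {M N : ℤ} (hMN : -M ≤ N)
    (hA : ∀ m : ℕ, ∑ j ∈ Finset.range m, h * (Real.pi * Real.cosh (N * h + (j + 1) * h) *
        Real.exp (-(Real.pi * β * Real.sinh (N * h + (j + 1) * h)))) ≤ B)
    (hB : ∀ m : ℕ, ∑ j ∈ Finset.range m, h * (Real.pi * Real.cosh (M * h + (j + 1) * h) *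
        Real.exp (-(Real.pi * α * Real.sinh (M * h + (j + 1) * h)))) ≤ A) :
    ‖(∫ t : ℝ, f (psi t) * deriv psi t) - h * ∑ k ∈ Finset.Icc (-M) N,
        f (psi ((k * h : ℝ) : ℂ)) * deriv psi ((k * h : ℝ) : ℂ)‖ ≤
      2 * (K * cTilde d ^ (1 - α) / Real.cos (Real.pi / 2 * Real.sin d) ^ (α + β) *
          (2 / (min α β * Real.cos d))) *
        (Real.exp (-(2 * Real.pi * d / h)) / (1 - Real.exp (-(2 * Real.pi * d / h)))) +
      K * Real.exp (Real.pi * (1 - α) / 12) * (A + B) := by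
  have hpi := Real.pi_pos
  have hcosd : 0 < Real.cos d := Real.cos_pos_of_mem_Ioo ⟨by linarith, hd⟩
  have hμ : 0 < min α β := lt_min hα hβ
  set g : ℂ → ℂ := fun ζ => f (psi ζ) * deriv psi ζ with hg
  set D := K * cTilde d ^ (1 - α) / Real.cos (Real.pi / 2 * Real.sin d) ^ (α + β) with hD
  set b := Real.pi * min α β * Real.cos d with hb
  have hb0 : 0 < b := by positivity
  obtain ⟨C, hC⟩ := exists_deMajorant_le hb0
  have hD0 : 0 ≤ D := by
    have hc := cos_pi_div_two_mul_sin_pos hd0 hd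
    have h1 : 0 < cConst d := by unfold cConst; positivity
    have h2 : 0 < cTilde d := by
      have := Real.log_pos (by linarith : 1 < 1 + cConst d)
      unfold cTilde; positivity
    positivity
  obtain ⟨hsum, hdisc⟩ := norm_integral_sub_mul_tsum_le (C := D * C) hd0 hh
    (differentiableOn_integrand hd hf) ((continuous_deMajorant b).const_mul D)
    (fun z hz => norm_integrand_le hd0 hd hK hα hα1 hβ hbound hz)
    (fun x => by rw [mul_assoc]; exact mul_le_mul_of_nonneg_left (hC x) hD0)
  rw [integral_const_mul, integral_deMajorant hb0,
    show 2 * Real.pi / b = 2 / (min α β * Real.cos d) by rw [hb]; field_simp] at hdisc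
  have hreal := fun x => norm_integrand_ofReal_le_exp hd0 hd hK hα hα1 hβ hbound x
  set K₂ := K * Real.exp (Real.pi * (1 - α) / 12) with hK₂
  have hK₂0 : 0 ≤ K₂ := by positivity
  -- The tails involve real nodes only, so `K₂`, with `exp (π / 12)` in place of `cTilde d`,
  -- applies.
  have htrunc := norm_tsum_sub_sum_Icc_le (u := fun k : ℤ => (h : ℂ) * g ((k * h : ℝ) : ℂ))
    (hsum.mul_left _) hMN (A := K₂ * B) (B := K₂ * A)
    (fun m => by
      refine le_trans ?_ (mul_le_mul_of_nonneg_left (hA m) hK₂0)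
      rw [Finset.mul_sum]
      refine Finset.sum_le_sum fun j _ => ?_
      have h1 := (hreal (N * h + (j + 1) * h)).1
      rw [norm_mul, Complex.norm_real, Real.norm_eq_abs, abs_of_pos hh]
      have e : ((N + (j + 1) : ℤ) : ℝ) * h = N * h + (j + 1) * h := by push_cast; ring
      rw [e]
      calc _ ≤ h * _ := mul_le_mul_of_nonneg_left h1 hh.le
        _ = _ := by ring)
    (fun m => by
      refine le_trans ?_ (mul_le_mul_of_nonneg_left (hB m) hK₂0)
      rw [Finset.mul_sum]
      refine Finset.sum_le_sum fun j _ => ?_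
      have h1 := (hreal (-(M * h + (j + 1) * h))).2
      rw [norm_mul, Complex.norm_real, Real.norm_eq_abs, abs_of_pos hh]
      have e : ((-(M + (j + 1)) : ℤ) : ℝ) * h = -(M * h + (j + 1) * h) := by push_cast; ring
      rw [e]
      rw [Real.cosh_neg, Real.sinh_neg, mul_neg] at h1
      calc _ ≤ h * _ := mul_le_mul_of_nonneg_left h1 hh.le
        _ = _ := by ring)
  rw [tsum_mul_left, ← Finset.mul_sum] at htrunc
  calc _ ≤ _ := norm_sub_le_norm_sub_add_norm_sub _ _ _
    _ ≤ _ := add_le_add hdisc htrunc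
    _ = _ := by ring

theorem integrable_integrand {d K α β : ℝ} (hd0 : 0 < d) (hd : d < Real.pi / 2)
    (hK : 0 < K) (hα : 0 < α) (hα1 : α ≤ 1) (hβ : 0 < β) {f : ℂ → ℂ}
    (hf : AnalyticOnNhd ℂ f (psi '' strip d))
    (hbound : ∀ z ∈ psi '' strip d, ‖f z‖ ≤ K * ‖E3 α β z‖) :
    Integrable fun t : ℝ => f (psi t) * deriv psi t := by
  have hpi := Real.pi_pos
  have hcosd : 0 < Real.cos d := Real.cos_pos_of_mem_Ioo ⟨by linarith, hd⟩
  have hμ : 0 < min α β := lt_min hα hβ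
  have hb0 : 0 < Real.pi * min α β * Real.cos d := by positivity
  -- The integral of a non-integrable function is `0` by convention, so a nonzero value proves
  -- integrability.
  have hint : Integrable (deMajorant (Real.pi * min α β * Real.cos d)) :=
    Integrable.of_integral_ne_zero (by rw [integral_deMajorant hb0]; positivity)
  refine (hint.const_mul _).mono' ?_ (Filter.Eventually.of_forall fun t =>
    norm_integrand_le hd0 hd hK hα hα1 hβ hbound (ofReal_mem_strip hd0 t))
  exact ((differentiableOn_integrand hd hf).continuousOn.comp_continuous
    Complex.continuous_ofReal (ofReal_mem_strip hd0)).aestronglyMeasurable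

end SincDE

theorem theorem2p11 (d : ℝ) (hd0 : 0 < d) (hd : d < Real.pi / 2)
    (K α β : ℝ) (hK : 0 < K) (hα : 0 < α) (hα1 : α ≤ 1) (hβ : 0 < β)
    (f : ℂ → ℂ)
    (hf : AnalyticOnNhd ℂ f (SincDE.psi '' SincDE.strip d))
    (hbound : ∀ z ∈ SincDE.psi '' SincDE.strip d, ‖f z‖ ≤ K * ‖SincDE.E3 α β z‖) :
    MeasureTheory.IntegrableOn (fun t : ℝ => f (t : ℂ)) (Set.Ioi 0) ∧
    (∀ (n : ℕ) (μ ν h : ℝ) (M N : ℤ),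
      μ = min α β → ν = max α β →
      h = SincDE.mesh d μ n →
      M = SincDE.lowerNum α β h n → N = SincDE.upperNum α β h n →
      ν * Real.exp 1 / (4 * d) ≤ n →
      SincDE.xThreshold α ≤ M * h → SincDE.xThreshold β ≤ N * h →
      ‖(∫ t in Set.Ioi (0 : ℝ), f (t : ℂ)) -
          (h : ℂ) * ∑ k ∈ Finset.Icc (-M) N,
            f (SincDE.psi ((k * h : ℝ) : ℂ)) * deriv SincDE.psi ((k * h : ℝ) : ℂ)‖
        ≤ SincDE.errorConst K α β d *
            Real.exp (-(2 * Real.pi * d * n / Real.log (4 * d * n / μ)))) ∧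
    (∀ c : ℝ, c = 8 ∨ c = 2 * Real.pi →
      (fun n : ℕ => Real.exp (-(2 * Real.pi * d * n / Real.log (4 * d * n / min α β))))
        =o[Filter.atTop]
      (fun n : ℕ => Real.exp (-(2 * Real.pi * d * n / Real.log (c * d * n / min α β))))) := by
  have hpi := Real.pi_pos
  have hμ0 : 0 < min α β := lt_min hα hβ
  refine ⟨(SincDE.integral_comp_psi f).1.2
    (SincDE.integrable_integrand hd0 hd hK hα hα1 hβ hf hbound), ?_, ?_⟩
  · intro n μ ν h M N hμ hν hh hM hN hn hMX hNX
    have hn0 : 0 < (n : ℝ) := by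
      refine lt_of_lt_of_le ?_ hn
      have : 0 < ν := hν ▸ lt_max_of_lt_left hα
      positivity
    have hμpos : 0 < μ := hμ ▸ hμ0
    have hμν : μ ≤ ν := by rw [hμ, hν]; exact min_le_max
    have hL1 := SincDE.one_le_log_of_le hd0 hμpos hμν rfl hn
    have heL := SincDE.exp_one_mul_log_le (by positivity : 0 < 4 * d * n / μ)
    obtain ⟨L, hL⟩ : ∃ L, L = Real.log (4 * d * n / μ) := ⟨_, rfl⟩
    rw [SincDE.mesh, ← hL] at hh
    rw [← hL] at hL1 heL ⊢
    have hL0 : 0 < L := by linarith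
    have hh0 : 0 < h := by rw [hh]; positivity
    have hnh : n * h = L := by rw [hh]; field_simp
    have hT : 0 < 4 * d * n := by positivity
    obtain ⟨hM1, hM2⟩ := SincDE.truncation_bounds hα hβ hh0 hT hnh (hμ ▸ hL) hM
    -- The upper number is the lower one with `α` and `β` exchanged.
    obtain ⟨hN1, hN2⟩ := SincDE.truncation_bounds hβ hα hh0 hT hnh
      (by rw [min_comm, ← hμ]; exact hL) (N := N) (by rw [min_comm β α]; exact hN)
    have hM0 : (0 : ℝ) ≤ M :=
      nonneg_of_mul_nonneg_left ((SincDE.xThreshold_nonneg hα).trans hMX) hh0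
    have hN0 : (0 : ℝ) ≤ N :=
      nonneg_of_mul_nonneg_left ((SincDE.xThreshold_nonneg hβ).trans hNX) hh0
    have hMN : -M ≤ N := by
      have h1 : 0 ≤ M := by exact_mod_cast hM0
      have h2 : 0 ≤ N := by exact_mod_cast hN0
      omega
    rw [(SincDE.integral_comp_psi f).2]
    refine (SincDE.norm_integral_sub_sum_le hd0 hd hK hα hα1 hβ hf hbound hh0 hMN
      (SincDE.tail_sum_le hβ hNX hh0 hL1 hN1 hT.le hN2)
      (SincDE.tail_sum_le hα hMX hh0 hL1 hM1 hT.le hM2)).trans ?_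
    have hcosd : 0 < Real.cos d := Real.cos_pos_of_mem_Ioo ⟨by linarith, hd⟩
    have hc := SincDE.cos_pi_div_two_mul_sin_pos hd0 hd
    have hct : 0 < SincDE.cTilde d := by
      have h1 : 0 < SincDE.cConst d := by unfold SincDE.cConst; positivity
      have := Real.log_pos (by linarith : 1 < 1 + SincDE.cConst d)
      unfold SincDE.cTilde; positivity
    rw [SincDE.errorConst, ← hμ, ← hν]
    have e1 : 2 * Real.pi * d / h = 2 * Real.pi * d * n / L := by
      rw [hh]; field_simp
    -- With `T = 4dn` the tail bound has the same exponent as the discretization error.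
    have e2 : Real.pi * (4 * d * n) / (2 * L) = 2 * Real.pi * d * n / L := by
      field_simp; ring
    rw [e1, e2]
    obtain ⟨E, hE⟩ : ∃ E, E = Real.exp (-(2 * Real.pi * d * n / L)) := ⟨_, rfl⟩
    have hE0 : 0 < E := hE ▸ Real.exp_pos _
    -- With `x = 4dn / μ` the exponent is `(πμ/2) x / log x`, and `x / log x ≥ e`; this makes the
    -- geometric series denominator independent of `n`.
    have hE1 : E ≤ Real.exp (-(Real.pi * μ * Real.exp 1 / 2)) := by
      rw [hE, Real.exp_le_exp, neg_le_neg_iff, le_div_iff₀ hL0]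
      rw [le_div_iff₀ hμpos] at heL
      nlinarith
    have hE2 : Real.exp (-(Real.pi * μ * Real.exp 1 / 2)) < 1 := by
      rw [Real.exp_lt_one_iff, neg_lt_zero]
      have := Real.exp_pos 1
      positivity
    rw [← hE, mul_add (2 * K / μ), add_mul (2 * K / μ * _)]
    refine add_le_add ?_ ?_
    · have h1 : E / (1 - E) ≤ E / (1 - Real.exp (-(Real.pi * μ * Real.exp 1 / 2))) := by
        gcongr
      refine (mul_le_mul_of_nonneg_left h1 (by positivity)).trans_eq ?_
      have : 1 - Real.exp (-(Real.pi * μ * Real.exp 1 / 2)) ≠ 0 := by linarith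
      field_simp
    · have hα2 : 1 / α * (Real.exp (Real.pi * α / 2) * E) ≤
          1 / μ * (Real.exp (Real.pi * ν / 2) * E) := by
        have h1 : μ ≤ α := hμ ▸ min_le_left _ _
        have h2 : α ≤ ν := hν ▸ le_max_left _ _
        gcongr
      have hβ2 : 1 / β * (Real.exp (Real.pi * β / 2) * E) ≤
          1 / μ * (Real.exp (Real.pi * ν / 2) * E) := by
        have h1 : μ ≤ β := hμ ▸ min_le_right _ _
        have h2 : β ≤ ν := hν ▸ le_max_right _ _
        gcongr
      refine (mul_le_mul_of_nonneg_left (add_le_add hα2 hβ2) (by positivity)).trans_eq ?_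
      have e3 : Real.exp (Real.pi * (1 - α + 6 * ν) / 12) =
          Real.exp (Real.pi * (1 - α) / 12) * Real.exp (Real.pi * ν / 2) := by
        rw [← Real.exp_add]; ring_nf
      rw [e3]
      ring
  · rintro c (rfl | rfl)
    · exact SincDE.isLittleO_exp_rate hd0 hμ0 (by norm_num)
    · exact SincDE.isLittleO_exp_rate hd0 hμ0 (by linarith [Real.pi_gt_three])
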